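/- Consider scheduling with testing on a single machine for instances with a uniform upper limit: there are $n$ jobs with a common upper limit $\bar p>0$ and processing times $p_j\in[0,\bar p]$. A job can be executed untested (taking time $\bar p$), or be tested (taking time $1$, which reveals $p_j$) and executed at any later time (taking time $p_j$). Initially only $n$ and $\bar p$ are known; the objective is the sum of completion times, and $\mathrm{Opt}(I)$ is the optimal offline cost of an instance $I$. Algorithm Beat: call a job short if $p_j\le E=\max\{1,\bar p-1\}$ and long otherwise, and set $\mathrm{TotalTest}=\mathrm{TotalExec}=0$. While there are untested jobs, let $k$ be a tested, not yet executed job with minimum $p_k$ ($p_k=\infty$ if there is none). If $\mathrm{TotalExec}+p_k\le\mathrm{TotalTest}$, execute $k$ and add $p_k$ to $\mathrm{TotalExec}$; otherwise test an arbitrary untested job $j$, and if $j$ is short execute it immediately, else add $1$ to $\mathrm{TotalTest}$. When all jobs have been tested, execute the remaining jobs in order of non-decreasing $p_j$. Algorithm Threshold (for $\bar p\ge 2$): test all jobs in an arbitrary order, execute a job with $p_j\le2$ immediately after its test, and execute the other jobs at the end in order of non-decreasing $p_j$. (For $\bar p<2$ it executes all jobs untested.) Theorem. The function $2p^3-4p^2+4p-1-\sqrt{(1-2p)^2(4p-3)}$,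 on the set of real $p$ where the square root is real, has exactly two zeros, $p=1$ and $p=T_1\approx1.9338$. The functions $$\frac{1+2(p-2)p+\sqrt{(1-2p)^2(4p-3)}}{2(p-1)p}\quad\text{and}\quad\frac{p-3+\sqrt{p^2+18p-15}}{2(p-1)}$$ coincide at exactly one point $T_2\approx2.2948$ of $(2,3)$. (Both approximations are correct to four decimals.) Consider the online algorithm that executes all jobs untested if $\bar p<T_1$, uses Beat if $T_1\le\bar p\le T_2$, and uses Threshold if $\bar p>T_2$. Such a deterministic online algorithm $\mathrm{Alg}$ exists, and, however its arbitrary choices are made, its asymptotic competitive ratio for instances with a uniform upper limit is $T_1$: $$\lim_{n\to\infty}\ \sup_{I}\ \frac{\mathrm{Alg}(I)}{\mathrm{Opt}(I)}=T_1,$$ where the supremum is over all instances $I$ with $n$ jobs and a uniform upper limit. -/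

import Mathlib

open Filter Topology

namespace SchedTest

/-- An instance of scheduling with testing on one machine with `n` jobs and a uniform upper
limit: every job takes time `ub` when it is executed untested, and job `j` takes time
`p j ∈ [0, ub]` when it is executed after its test. -/
structure UniformInstance (n : ℕ) where
  ub : ℝ
  ub_pos : 0 < ub
  p : Fin n → ℝ
  p_nonneg : ∀ j, 0 ≤ p j
  p_le : ∀ j, p j ≤ ub

/-- The operations of the machine: test a job (one unit of time), or execute a job. -/
inductive Action (n : ℕ) where
  | test (j : Fin n) : Action n
  | exec (j : Fin n) : Action n
deriving DecidableEq

/-- A schedule is the sequence of operations that the machine performs, one after the other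
and without idle time. It is complete and feasible if every job is executed exactly once, is
tested at most once, and is not tested after its execution. -/
def IsSchedule {n : ℕ} (s : List (Action n)) : Prop :=
  ∀ j : Fin n, s.count (Action.exec j) = 1 ∧ s.count (Action.test j) ≤ 1 ∧
    ¬ [Action.exec j, Action.test j].Sublist s

/-- The sum of the completion times of the jobs executed in the given sequence of operations,
when the sequence starts at time `t` and `tested` is the set of jobs already tested. -/
noncomputable def costFrom {n : ℕ} (I : UniformInstance n) :
    ℝ → Finset (Fin n) → List (Action n) → ℝ
  | _, _, [] => 0
  | t, tested, Action.test j :: s => costFrom I (t + 1) (insert j tested) s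
  | t, tested, Action.exec j :: s =>
      (t + if j ∈ tested then I.p j else I.ub) +
        costFrom I (t + if j ∈ tested then I.p j else I.ub) tested s

/-- The objective value (sum of completion times) of a schedule. -/
noncomputable def cost {n : ℕ} (I : UniformInstance n) (s : List (Action n)) : ℝ :=
  costFrom I 0 ∅ s

/-- The optimal (offline) cost of an instance. -/
noncomputable def opt {n : ℕ} (I : UniformInstance n) : ℝ :=
  sInf {c : ℝ | ∃ s : List (Action n), IsSchedule s ∧ cost I s = c}

/-- What an algorithm has observed after performing the operations in `s`: the operations
themselves, and the processing times revealed by the tests among them. -/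
def observe {n : ℕ} (I : UniformInstance n) (s : List (Action n)) :
    List (Action n × Option ℝ) :=
  s.map fun a =>
    match a with
    | Action.test j => (Action.test j, some (I.p j))
    | Action.exec j => (Action.exec j, none)

/-- A deterministic online algorithm: given the number of jobs, the uniform upper limit and the
observations so far, it chooses the next operation (`none`: it stops). -/
def OnlineAlgorithm : Type :=
  (n : ℕ) → (ub : ℝ) → List (Action n × Option ℝ) → Option (Action n)

/-- Continue the sequence of operations `s` by at most `k` further operations of `A`. -/
noncomputable def OnlineAlgorithm.runFrom (A : OnlineAlgorithm) {n : ℕ} (I : UniformInstance n) :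
    ℕ → List (Action n) → List (Action n)
  | 0, s => s
  | k + 1, s =>
      match A n I.ub (observe I s) with
      | none => s
      | some a => A.runFrom I k (s ++ [a])

/-- The schedule that `A` produces for `I`. (A feasible schedule has at most `2 * n` operations.) -/
noncomputable def OnlineAlgorithm.schedule (A : OnlineAlgorithm) {n : ℕ}
    (I : UniformInstance n) : List (Action n) :=
  A.runFrom I (2 * n) []

/-- The limit, as the number `n` of jobs tends to infinity, of the supremum of `A(I) / Opt(I)`
over all instances `I` with `n` jobs and a uniform upper limit exists and equals `ρ`. The supremum
is taken in `[0, ∞]`. -/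
def OnlineAlgorithm.HasAsymptoticRatio (A : OnlineAlgorithm) (ρ : ℝ) : Prop :=
  Tendsto (fun n : ℕ => ⨆ I : UniformInstance n, ENNReal.ofReal (cost I (A.schedule I) / opt I))
    atTop (𝓝 (ENNReal.ofReal ρ))

/-- `s` executes exactly the jobs in `R`, in some order of non-decreasing processing time. -/
def ExecSorted {n : ℕ} (I : UniformInstance n) (R : Finset (Fin n)) (s : List (Action n)) : Prop :=
  ∃ l : List (Fin n), l.Nodup ∧ l.toFinset = R ∧ l.Pairwise (fun i j => I.p i ≤ I.p j) ∧
    s = l.map Action.exec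

/-- `s` executes all jobs without tests, in an arbitrary order. -/
def UntestedRun {n : ℕ} (s : List (Action n)) : Prop :=
  ∃ l : List (Fin n), l.Nodup ∧ (∀ j, j ∈ l) ∧ s = l.map Action.exec

/-- The possible sequences of operations of the algorithm Beat with bound `E` for short jobs,
from the state in which `U` is the set of untested jobs, `P` is the set of jobs that are tested
but not executed, and `tt`, `te` are the values of TotalTest and TotalExec. The choice of the
next job to test, and of a job of minimum processing time among several, is arbitrary. -/
inductive BeatFrom {n : ℕ} (I : UniformInstance n) (E : ℝ) :
    Finset (Fin n) → Finset (Fin n) → ℝ → ℝ → List (Action n) → Prop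
  | finish {P : Finset (Fin n)} {tt te : ℝ} {s : List (Action n)} (hs : ExecSorted I P s) :
      BeatFrom I E ∅ P tt te s
  | execLong {U P : Finset (Fin n)} {tt te : ℝ} {s : List (Action n)} {k : Fin n}
      (hU : U.Nonempty) (hk : k ∈ P) (hmin : ∀ i ∈ P, I.p k ≤ I.p i) (hle : te + I.p k ≤ tt)
      (hs : BeatFrom I E U (P.erase k) tt (te + I.p k) s) :
      BeatFrom I E U P tt te (Action.exec k :: s)
  | testShort {U P : Finset (Fin n)} {tt te : ℝ} {s : List (Action n)} {j : Fin n}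
      (hj : j ∈ U) (hwait : ∀ i ∈ P, tt < te + I.p i) (hshort : I.p j ≤ E)
      (hs : BeatFrom I E (U.erase j) P tt te s) :
      BeatFrom I E U P tt te (Action.test j :: Action.exec j :: s)
  | testLong {U P : Finset (Fin n)} {tt te : ℝ} {s : List (Action n)} {j : Fin n}
      (hj : j ∈ U) (hwait : ∀ i ∈ P, tt < te + I.p i) (hlong : E < I.p j)
      (hs : BeatFrom I E (U.erase j) (insert j P) (tt + 1) te s) :
      BeatFrom I E U P tt te (Action.test j :: s)

/-- `s` is a schedule that the algorithm Beat can produce for `I`. -/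
def BeatRun {n : ℕ} (I : UniformInstance n) (s : List (Action n)) : Prop :=
  BeatFrom I (max 1 (I.ub - 1)) Finset.univ ∅ 0 0 s

/-- The possible sequences of operations of the testing part of the algorithm Threshold, from the
state in which `U` is the set of untested jobs and `P` is the set of deferred jobs. -/
inductive ThresholdFrom {n : ℕ} (I : UniformInstance n) :
    Finset (Fin n) → Finset (Fin n) → List (Action n) → Prop
  | finish {P : Finset (Fin n)} {s : List (Action n)} (hs : ExecSorted I P s) :
      ThresholdFrom I ∅ P s
  | testShort {U P : Finset (Fin n)} {s : List (Action n)} {j : Fin n}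
      (hj : j ∈ U) (hshort : I.p j ≤ 2) (hs : ThresholdFrom I (U.erase j) P s) :
      ThresholdFrom I U P (Action.test j :: Action.exec j :: s)
  | testLong {U P : Finset (Fin n)} {s : List (Action n)} {j : Fin n}
      (hj : j ∈ U) (hlong : 2 < I.p j) (hs : ThresholdFrom I (U.erase j) (insert j P) s) :
      ThresholdFrom I U P (Action.test j :: s)

/-- `s` is a schedule that the algorithm Threshold can produce for `I`: jobs are executed without
test if the upper limit is less than `2`, and otherwise all jobs are tested. -/
def ThresholdRun {n : ℕ} (I : UniformInstance n) (s : List (Action n)) : Prop :=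
  (I.ub < 2 → UntestedRun s) ∧ (2 ≤ I.ub → ThresholdFrom I Finset.univ ∅ s)

/-- `A` is an implementation of the combined algorithm: no tests if the upper limit is less than
`T₁`, Threshold if it is greater than `T₂`, and Beat otherwise. -/
def OnlineAlgorithm.ImplementsCombined (A : OnlineAlgorithm) (T₁ T₂ : ℝ) : Prop :=
  ∀ (n : ℕ) (I : UniformInstance n),
    (I.ub < T₁ → UntestedRun (A.schedule I)) ∧
    (T₁ ≤ I.ub → I.ub ≤ T₂ → BeatRun I (A.schedule I)) ∧
    (T₁ ≤ I.ub → T₂ < I.ub → ThresholdRun I (A.schedule I))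

/-- The function that bounds the asymptotic competitive ratio of Beat for upper limit `x`. -/
noncomputable def rhoBeat (x : ℝ) : ℝ :=
  (1 + 2 * (-2 + x) * x + Real.sqrt ((1 - 2 * x) ^ 2 * (-3 + 4 * x))) / (2 * (-1 + x) * x)

/-- The function that bounds the asymptotic competitive ratio of Threshold for upper limit
`x ∈ (2, 3)`. -/
noncomputable def rhoThreshold (x : ℝ) : ℝ :=
  (-3 + x + Real.sqrt (-15 + x * (18 + x))) / (2 * (x - 1))

end SchedTest

/-! Charge every delay to the pair of jobs involved (a job's own time to the pair with itself); then
every cost is compared through sums over unordered pairs. Offline, job `j` needs at least `q j = min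
ub (1 + p j)`, so no schedule costs less than the pair sum of `min (q i) (q j)`
(`pairSum_offline_le_opt`). For the algorithms the test order is taken as bad as possible: two short
jobs contribute at most `1 + max (p i) (p j)`, and for Beat the bound is, up to lower order terms,
that of testing all long jobs before the short ones, while TotalExec stays within a constant of
TotalTest (`costFrom_le_of_thresholdFrom`, `costFrom_le_of_beatFrom`).

By `sum_sum_short_le`, twice the difference of the algorithm's cost and `T₁ * opt` is then bounded
by a quadratic form in the number `k` of short jobs, their total processing time `S` and the number
`z` of long jobs, plus a term linear in `n` for Beat. For Threshold the form is nonpositive with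
numerical slack. For Beat, completing the square leaves a polynomial condition on `ub` that is an
equality at `ub = T₁`: there `rhoBeat x = x`, which is the cubic equation with the square root, and
`polyOne` is what remains of it after squaring. The point `T₂` enters the cost bounds only through
its numerical enclosure. Since `opt ≥ n ^ 2 / 2` once `ub ≥ 1`, the linear term disappears in the
limit.

The ratio is not smaller: with all processing times `0` and `1 < ub < T₁`, executing everything
untested costs exactly `ub` times the optimum, and `ub` may approach `T₁`. -/

namespace SchedTest

/-! ### Pair sums and the lower bound for the optimum -/

/-- The sum of a symmetric function over the unordered pairs of elements of `R`, including the
pairs of equal elements. -/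
noncomputable def pairSum {ι : Type*} (m : ι → ι → ℝ) (R : Finset ι) : ℝ :=
  (∑ i ∈ R, ∑ j ∈ R, m i j + ∑ i ∈ R, m i i) / 2

lemma pairSum_empty {ι : Type*} (m : ι → ι → ℝ) : pairSum m ∅ = 0 := by simp [pairSum]

lemma pairSum_erase {ι : Type*} [DecidableEq ι] {m : ι → ι → ℝ} (hm : ∀ i j, m i j = m j i)
    {R : Finset ι} {j : ι} (hj : j ∈ R) :
    pairSum m R = pairSum m (R.erase j) + ∑ i ∈ R, m i j := by
  have h : ∀ f : ι → ℝ, ∑ i ∈ R, f i = f j + ∑ i ∈ R.erase j, f i :=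
    fun f => (Finset.add_sum_erase R f hj).symm
  have h2 : ∑ i ∈ R.erase j, m j i = ∑ i ∈ R.erase j, m i j :=
    Finset.sum_congr rfl fun i _ => hm j i
  simp only [pairSum, h, Finset.sum_add_distrib, h2]
  ring

lemma pairSum_mono {ι : Type*} {m m' : ι → ι → ℝ} {R : Finset ι}
    (h : ∀ i ∈ R, ∀ j ∈ R, m i j ≤ m' i j) : pairSum m R ≤ pairSum m' R := by
  have h1 : ∑ i ∈ R, ∑ j ∈ R, m i j ≤ ∑ i ∈ R, ∑ j ∈ R, m' i j :=
    Finset.sum_le_sum fun i hi => Finset.sum_le_sum fun j hj => h i hi j hj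
  have h2 : ∑ i ∈ R, m i i ≤ ∑ i ∈ R, m' i i := Finset.sum_le_sum fun i hi => h i hi i hi
  simp only [pairSum]
  linarith

lemma pairSum_const {ι : Type*} (c : ℝ) (R : Finset ι) :
    pairSum (fun _ _ => c) R = c * (R.card * (R.card + 1)) / 2 := by
  simp [pairSum]
  ring

/-- The time that an optimal schedule spends on job `j`. -/
noncomputable def UniformInstance.offline {n : ℕ} (I : UniformInstance n) (j : Fin n) : ℝ :=
  min I.ub (1 + I.p j)

lemma pairSum_min_erase_le {ι : Type*} [DecidableEq ι] (q : ι → ℝ) {R : Finset ι} {j : ι}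
    (hj : j ∈ R) : pairSum (fun a b => min (q a) (q b)) R ≤
      pairSum (fun a b => min (q a) (q b)) (R.erase j) + R.card * q j := by
  rw [pairSum_erase (fun a b => min_comm _ _) hj]
  have : ∑ i ∈ R, min (q i) (q j) ≤ ∑ _i ∈ R, q j :=
    Finset.sum_le_sum fun i _ => min_le_right _ _
  rw [Finset.sum_const, nsmul_eq_mul] at this
  linarith

/-- Potential argument. Each tested job that is still to be executed has already used one unit of
its offline time before `t`, so `t` is reduced by the number of such jobs. A test leaves the reduced
time at least as large; executing `j` raises it by at least `offline j`, and removing `j` lowers the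
pair sum by at most `R.card * offline j`. -/
lemma pairSum_offline_le_costFrom {n : ℕ} (I : UniformInstance n) (s : List (Action n)) :
    ∀ (t : ℝ) (D R : Finset (Fin n)),
      (∀ j, s.count (Action.exec j) = if j ∈ R then 1 else 0) →
      R.card * (t - (D ∩ R).card) + pairSum (fun i j => min (I.offline i) (I.offline j)) R
        ≤ costFrom I t D s := by
  induction s with
  | nil =>
    intro t D R h
    have hR : R = ∅ := by
      ext j
      have := h j
      simp at this
      simp [this]
    subst hR
    simp [pairSum_empty, costFrom]
  | cons a s ih =>
    intro t D R h
    cases a with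
    | test j =>
      have := ih (t + 1) (insert j D) R (fun i => by rw [← h i]; simp)
      refine le_trans ?_ this
      have hc : ((insert j D) ∩ R).card ≤ (D ∩ R).card + 1 := by
        refine le_trans (Finset.card_le_card ?_) (Finset.card_insert_le j (D ∩ R))
        intro x hx
        simp only [Finset.mem_inter, Finset.mem_insert] at hx ⊢
        tauto
      have hc' : (((insert j D) ∩ R).card : ℝ) ≤ (D ∩ R).card + 1 := by exact_mod_cast hc
      gcongr ?_ * ?_ + _
      linarith
    | exec j =>
      have hj : j ∈ R := by
        by_contra hj
        have := h j
        simp [hj] at this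
      have h' : ∀ i, s.count (Action.exec i) = if i ∈ R.erase j then 1 else 0 := by
        intro i
        have := h i
        rw [List.count_cons] at this
        by_cases hij : i = j
        · subst hij
          simp [hj] at this
          simp [this]
        · have hne : ¬ (j = i) := fun h => hij h.symm
          simpa [hij, hne] using this
      have hI := ih (t + if j ∈ D then I.p j else I.ub) D (R.erase j) h'
      have hE := pairSum_min_erase_le I.offline hj
      have hcard : (R.card : ℝ) = (R.erase j).card + 1 := by
        rw [Finset.card_erase_of_mem hj, Nat.cast_sub (Finset.card_pos.2 ⟨j, hj⟩)]; simp
      have hq1 : I.offline j ≤ I.ub := min_le_left _ _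
      have hq2 : I.offline j ≤ 1 + I.p j := min_le_right _ _
      -- If `j` was tested, it leaves the count of tested jobs, which supplies the missing unit of
      -- `1 + p j`; otherwise it takes the full time `ub`.
      have key : I.offline j + (t - (D ∩ R).card) ≤
          (t + if j ∈ D then I.p j else I.ub) - (D ∩ R.erase j).card := by
        rw [Finset.inter_erase]
        by_cases hD : j ∈ D
        · have hm : j ∈ D ∩ R := Finset.mem_inter.2 ⟨hD, hj⟩
          rw [Finset.card_erase_of_mem hm, Nat.cast_sub (Finset.card_pos.2 ⟨j, hm⟩)]
          simp [hD]; linarith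
        · have hm : j ∉ D ∩ R := fun h => hD (Finset.mem_inter.1 h).1
          rw [Finset.erase_eq_of_notMem hm]
          simp [hD]; linarith
      have h0 : (0 : ℝ) ≤ (D ∩ R.erase j).card := Nat.cast_nonneg _
      have h1 := mul_le_mul_of_nonneg_left key (Nat.cast_nonneg (α := ℝ) (R.erase j).card)
      simp only [costFrom]
      rw [hcard] at hE ⊢
      nlinarith

lemma pairSum_offline_le_cost {n : ℕ} (I : UniformInstance n) {s : List (Action n)}
    (hs : IsSchedule s) :
    pairSum (fun i j => min (I.offline i) (I.offline j)) Finset.univ ≤ cost I s := by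
  have := pairSum_offline_le_costFrom I s 0 ∅ Finset.univ (fun j => by simp [(hs j).1])
  simpa [cost] using this

/-- The schedule that tests and immediately executes the jobs in the given order. -/
def testExec {n : ℕ} (l : List (Fin n)) : List (Action n) :=
  l.flatMap fun j => [Action.test j, Action.exec j]

lemma count_test_testExec {n : ℕ} (l : List (Fin n)) (j : Fin n) :
    (testExec l).count (Action.test j) = l.count j := by
  induction l with
  | nil => simp [testExec]
  | cons a l ih => simp only [testExec] at ih; simp [testExec, List.count_cons, ih]

lemma count_exec_testExec {n : ℕ} (l : List (Fin n)) (j : Fin n) :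
    (testExec l).count (Action.exec j) = l.count j := by
  induction l with
  | nil => simp [testExec]
  | cons a l ih => simp only [testExec] at ih; simp [testExec, List.count_cons, ih]

lemma not_sublist_testExec {n : ℕ} {l : List (Fin n)} (hl : l.Nodup) (j : Fin n) :
    ¬ [Action.exec j, Action.test j].Sublist (testExec l) := by
  induction l with
  | nil => simp [testExec]
  | cons a l ih =>
    have ih := ih (List.nodup_cons.1 hl).2
    intro h
    have h : [Action.exec j, Action.test j].Sublist
        (Action.test a :: Action.exec a :: testExec l) := by simpa [testExec] using h
    rw [List.sublist_cons_iff] at h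
    rcases h with h | ⟨r, hr, -⟩
    · rw [List.sublist_cons_iff] at h
      rcases h with h | ⟨r, hr, h⟩
      · exact ih h
      · simp only [List.cons.injEq, Action.exec.injEq] at hr
        obtain ⟨rfl, rfl⟩ := hr
        have hm : Action.test j ∈ testExec l := List.singleton_sublist.1 h
        rw [← List.count_pos_iff, count_test_testExec, List.count_pos_iff] at hm
        exact (List.nodup_cons.1 hl).1 hm
    · simp at hr

lemma isSchedule_testExec_finRange (n : ℕ) : IsSchedule (testExec (List.finRange n)) := by
  intro j
  have h : (List.finRange n).count j = 1 :=
    List.count_eq_one_of_mem (List.nodup_finRange n) (List.mem_finRange j)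
  rw [count_test_testExec, count_exec_testExec, h]
  exact ⟨rfl, le_rfl, not_sublist_testExec (List.nodup_finRange n) j⟩

lemma pairSum_offline_le_opt {n : ℕ} (I : UniformInstance n) :
    pairSum (fun i j => min (I.offline i) (I.offline j)) Finset.univ ≤ opt I := by
  refine le_csInf ⟨_, _, isSchedule_testExec_finRange n, rfl⟩ ?_
  rintro c ⟨s, hs, rfl⟩
  exact pairSum_offline_le_cost I hs

lemma opt_le_cost {n : ℕ} (I : UniformInstance n) {s : List (Action n)} (hs : IsSchedule s) :
    opt I ≤ cost I s := by
  refine csInf_le ⟨pairSum (fun i j => min (I.offline i) (I.offline j)) Finset.univ, ?_⟩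
    ⟨s, hs, rfl⟩
  rintro c ⟨s, hs, rfl⟩
  exact pairSum_offline_le_cost I hs

lemma le_opt {n : ℕ} (I : UniformInstance n) {c : ℝ} (h1 : c ≤ I.ub) (h2 : c ≤ 1) :
    c * (n * (n + 1)) / 2 ≤ opt I := by
  refine le_trans ?_ (pairSum_offline_le_opt I)
  have h : ∀ j, c ≤ I.offline j := fun j => le_min h1 (by have := I.p_nonneg j; linarith)
  have := pairSum_mono (m := fun _ _ => c) (m' := fun i j => min (I.offline i) (I.offline j))
    (R := Finset.univ) (fun i _ j _ => le_min (h i) (h j))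
  simpa [pairSum_const] using this

/-! ### Zero processing times and untested execution -/

lemma costFrom_testExec {n : ℕ} (I : UniformInstance n) (hI : ∀ j, I.p j = 0)
    (l : List (Fin n)) : ∀ (t : ℝ) (D : Finset (Fin n)),
      costFrom I t D (testExec l) = t * l.length + l.length * (l.length + 1) / 2 := by
  induction l with
  | nil => simp [testExec, costFrom]
  | cons a l ih =>
    intro t D
    have h : testExec (a :: l) = Action.test a :: Action.exec a :: testExec l := by
      simp [testExec]
    simp [h, costFrom, ih, hI]
    ring

lemma opt_le_of_p_eq_zero {n : ℕ} (I : UniformInstance n) (hI : ∀ j, I.p j = 0) :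
    opt I ≤ n * (n + 1) / 2 := by
  refine (opt_le_cost I (isSchedule_testExec_finRange n)).trans_eq ?_
  simp [cost, costFrom_testExec I hI]

lemma costFrom_map_exec {n : ℕ} (I : UniformInstance n) (l : List (Fin n)) : ∀ t : ℝ,
    costFrom I t ∅ (l.map Action.exec) = t * l.length + I.ub * (l.length * (l.length + 1)) / 2 := by
  induction l with
  | nil => simp [costFrom]
  | cons a l ih =>
    intro t
    simp [costFrom, ih]
    ring

lemma cost_of_untestedRun {n : ℕ} (I : UniformInstance n) {s : List (Action n)}
    (hs : UntestedRun s) : cost I s = I.ub * (n * (n + 1)) / 2 := by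
  obtain ⟨l, hl, hm, rfl⟩ := hs
  have hlen : l.length = n := by
    rw [← List.toFinset_card_of_nodup hl, show l.toFinset = Finset.univ by ext; simp [hm]]
    simp
  simp [cost, costFrom_map_exec, hlen]

/-- For `ub ≤ 1` testing never pays and the run is optimal; for `ub ≥ 1` every job takes at least
one unit offline, so the ratio is at most `ub`. -/
lemma cost_le_of_untestedRun {n : ℕ} (I : UniformInstance n) {s : List (Action n)}
    (hs : UntestedRun s) {R : ℝ} (h1 : 1 ≤ R) (h2 : I.ub ≤ R) : cost I s ≤ R * opt I := by
  rw [cost_of_untestedRun I hs]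
  have hn : (0 : ℝ) ≤ n * (n + 1) := by positivity
  rcases le_total I.ub 1 with h | h
  · have := le_opt I le_rfl h
    have h0 : 0 ≤ opt I := le_trans (by have := I.ub_pos; positivity) this
    nlinarith
  · have := le_opt I h le_rfl
    nlinarith [mul_le_mul_of_nonneg_right h2 hn]

/-! ### The switching points -/

/-- The polynomial whose root in `(3/4, ∞)` is `T₁`. -/
def polyOne (x : ℝ) : ℝ := x ^ 5 - 3 * x ^ 4 + 5 * x ^ 3 - 8 * x ^ 2 + 5 * x - 1

/-- The polynomial whose root in `(2, 3)` is `T₂`. -/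
def polyTwo (x : ℝ) : ℝ :=
  -4 * x ^ 6 + 12 * x ^ 5 - 13 * x ^ 4 + 24 * x ^ 3 - 24 * x ^ 2 + 8 * x - 1

lemma polyOne_neg {x : ℝ} (h1 : 3 / 4 ≤ x) (h2 : x ≤ 19 / 10) : polyOne x < 0 := by
  have h : polyOne x = x ^ 2 * (x - 1) ^ 3 + x * (x - 1) * (2 * x - 1) - (2 * x - 1) ^ 2 := by
    unfold polyOne; ring
  rw [h]
  rcases le_total x 1 with hx | hx
  · nlinarith [mul_nonneg (mul_nonneg (sub_nonneg.2 hx) (sq_nonneg (x - 1))) (sq_nonneg x),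
      mul_nonneg (mul_nonneg (by linarith : (0:ℝ) ≤ x) (sub_nonneg.2 hx)) (by linarith : (0:ℝ) ≤ 2 * x - 1),
      sq_pos_of_pos (by linarith : (0:ℝ) < 2 * x - 1)]
  -- Bounding `x ^ 2 * (x - 1)` and one factor `x` by their values at `19 / 10` leaves a convex
  -- quadratic, negative at both ends of `[1, 19 / 10]`.
  · have a : x ^ 2 * (x - 1) ≤ 19 / 10 * (19 / 10) * (9 / 10) := by
      rw [pow_two]; gcongr; linarith
    have h3 : (x - 1) ^ 2 * (x ^ 2 * (x - 1)) ≤ (x - 1) ^ 2 * (19 / 10 * (19 / 10) * (9 / 10)) := by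
      gcongr
    have e : x * (x - 1) * (2 * x - 1) ≤ 19 / 10 * ((x - 1) * (2 * x - 1)) := by
      rw [mul_assoc]; gcongr
      · exact mul_nonneg (by linarith) (by linarith)
    nlinarith [mul_nonneg (sub_nonneg.2 hx) (sub_nonneg.2 h2)]

/-- Expanded around `19 / 10`, all coefficients of the difference in the nonnegative shifts are
positive. -/
lemma polyOne_strictMono {x y : ℝ} (h1 : 19 / 10 ≤ x) (h : x < y) : polyOne x < polyOne y := by
  obtain ⟨a, rfl⟩ : ∃ a, x = 19 / 10 + a := ⟨x - 19 / 10, by ring⟩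
  obtain ⟨b, rfl⟩ : ∃ b, y = 19 / 10 + a + b := ⟨y - (19 / 10 + a), by ring⟩
  have ha : 0 ≤ a := by linarith
  have hb : 0 < b := by linarith
  have : 0 < polyOne (19 / 10 + a + b) - polyOne (19 / 10 + a) := by
    unfold polyOne; ring_nf; positivity
  linarith

lemma polyTwo_strictAnti {x y : ℝ} (h1 : 2 ≤ x) (h : x < y) : polyTwo y < polyTwo x := by
  obtain ⟨a, rfl⟩ : ∃ a, x = 2 + a := ⟨x - 2, by ring⟩
  obtain ⟨b, rfl⟩ : ∃ b, y = 2 + a + b := ⟨y - (2 + a), by ring⟩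
  have ha : 0 ≤ a := by linarith
  have hb : 0 < b := by linarith
  have : 0 < polyTwo (2 + a) - polyTwo (2 + a + b) := by
    unfold polyTwo; ring_nf; positivity
  linarith

lemma exists_polyOne_root : ∃ x : ℝ, 193375 / 100000 < x ∧ x < 193385 / 100000 ∧ polyOne x = 0 := by
  have hc : ContinuousOn polyOne (Set.Icc (193375 / 100000) (193385 / 100000)) := by
    unfold polyOne; fun_prop
  obtain ⟨x, hx, h⟩ := intermediate_value_Ioo (by norm_num) hc
    (show (0 : ℝ) ∈ _ by constructor <;> norm_num [polyOne])
  exact ⟨x, hx.1, hx.2, h⟩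

lemma exists_polyTwo_root : ∃ x : ℝ, 229475 / 100000 < x ∧ x < 229485 / 100000 ∧ polyTwo x = 0 := by
  have hc : ContinuousOn polyTwo (Set.Icc (229475 / 100000) (229485 / 100000)) := by
    unfold polyTwo; fun_prop
  obtain ⟨x, hx, h⟩ := intermediate_value_Ioo' (by norm_num) hc
    (show (0 : ℝ) ∈ _ by constructor <;> norm_num [polyTwo])
  exact ⟨x, hx.1, hx.2, h⟩

lemma cubic_eq_sqrt_iff {T : ℝ} (hT : 193375 / 100000 < T) (hT0 : polyOne T = 0) {x : ℝ}
    (hx : 0 ≤ (1 - 2 * x) ^ 2 * (4 * x - 3)) :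
    2 * x ^ 3 - 4 * x ^ 2 + 4 * x - 1 - Real.sqrt ((1 - 2 * x) ^ 2 * (4 * x - 3)) = 0 ↔
      x = 1 ∨ x = T := by
  have key : (2 * x ^ 3 - 4 * x ^ 2 + 4 * x - 1) ^ 2 - (1 - 2 * x) ^ 2 * (4 * x - 3) =
      4 * (x - 1) * polyOne x := by unfold polyOne; ring
  have hs := Real.sq_sqrt hx
  constructor
  · intro h
    have h2 : (x - 1) * polyOne x = 0 := by
      rw [← sub_eq_zero.1 h] at hs
      linarith
    rcases mul_eq_zero.1 h2 with h3 | h3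
    · left; linarith
    · right
      have hx34 : 3 / 4 ≤ x := by
        by_contra hlt
        push Not at hlt
        -- Below `3 / 4` the radicand is nonnegative only at its double zero `1 / 2`.
        have h5 : (1 - 2 * x) ^ 2 = 0 := by
          by_contra hne
          have : 0 < (1 - 2 * x) ^ 2 := lt_of_le_of_ne (sq_nonneg _) (Ne.symm hne)
          nlinarith
        have h6 : x = 1 / 2 := by
          have := pow_eq_zero_iff (two_ne_zero) |>.1 h5
          linarith
        subst h6
        norm_num [polyOne] at h3
      have h19 : 19 / 10 < x := by
        by_contra hle
        have := polyOne_neg hx34 (not_lt.1 hle)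
        linarith
      rcases lt_trichotomy x T with h | h | h
      · have := polyOne_strictMono h19.le h; linarith
      · exact h
      · have := polyOne_strictMono (by linarith) h; linarith
  · intro h
    have h2 : (2 * x ^ 3 - 4 * x ^ 2 + 4 * x - 1) ^ 2 = (1 - 2 * x) ^ 2 * (4 * x - 3) := by
      rcases h with rfl | rfl
      · norm_num
      · rw [hT0] at key; linarith
    have hpos : 0 ≤ 2 * x ^ 3 - 4 * x ^ 2 + 4 * x - 1 := by
      have : 1 ≤ x := by rcases h with rfl | rfl <;> linarith
      nlinarith [mul_nonneg (by linarith : (0:ℝ) ≤ x) (sq_nonneg (x - 1))]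
    rw [← h2, Real.sqrt_sq hpos, sub_self]

/-- In terms of the excess `a` over `1`, isolating the square root leaves a positive other side, so
squaring is an equivalence. -/
lemma rhoBeat_eq_iff {x a : ℝ} (hx : 1 < x) (ha : 0 < a) :
    rhoBeat x = 1 + a ↔ a ^ 2 * (x - 1) * x ^ 2 + a * x * (2 * x - 1) - (2 * x - 1) ^ 2 = 0 := by
  have hd : 2 * (-1 + x) * x ≠ 0 := by
    have : 0 < (-1 + x) := by linarith
    positivity
  have hs : Real.sqrt ((1 - 2 * x) ^ 2 * (-3 + 4 * x)) = 2 * (x - 1) * x * a + (2 * x - 1) ↔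
      (1 - 2 * x) ^ 2 * (-3 + 4 * x) = (2 * (x - 1) * x * a + (2 * x - 1)) ^ 2 := by
    have h0 : 0 < 2 * (x - 1) * x * a + (2 * x - 1) := by
      have : 0 < x - 1 := by linarith
      have : 0 < 2 * x - 1 := by linarith
      positivity
    rw [Real.sqrt_eq_iff_eq_sq ?_ h0.le]
    exact mul_nonneg (sq_nonneg _) (by linarith)
  unfold rhoBeat
  rw [div_eq_iff hd]
  have e1 : 1 + 2 * (-2 + x) * x + Real.sqrt ((1 - 2 * x) ^ 2 * (-3 + 4 * x)) =
      (1 + a) * (2 * (-1 + x) * x) ↔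
      Real.sqrt ((1 - 2 * x) ^ 2 * (-3 + 4 * x)) = 2 * (x - 1) * x * a + (2 * x - 1) := by
    constructor <;> intro h <;> linarith
  rw [e1, hs]
  have e2 : (2 * (x - 1) * x * a + (2 * x - 1)) ^ 2 - (1 - 2 * x) ^ 2 * (-3 + 4 * x) =
    4 * (x - 1) * (a ^ 2 * (x - 1) * x ^ 2 + a * x * (2 * x - 1) - (2 * x - 1) ^ 2) := by ring
  have hx1 : 4 * (x - 1) ≠ 0 := by
    have : 0 < x - 1 := by linarith
    positivity
  rw [eq_comm, ← sub_eq_zero, e2, mul_eq_zero, or_iff_right hx1]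

lemma rhoThreshold_eq_iff {x a : ℝ} (hx : 1 < x) (ha : 0 < a) :
    rhoThreshold x = 1 + a ↔ a ^ 2 * (x - 1) + a * (x + 1) - 4 = 0 := by
  have hx1 : 0 < x - 1 := by linarith
  have hd : 2 * (x - 1) ≠ 0 := by positivity
  have hs : Real.sqrt (-15 + x * (18 + x)) = 2 * (x - 1) * a + (x + 1) ↔
      -15 + x * (18 + x) = (2 * (x - 1) * a + (x + 1)) ^ 2 := by
    have h0 : 0 < 2 * (x - 1) * a + (x + 1) := by
      have : 0 < x + 1 := by linarith
      positivity
    rw [Real.sqrt_eq_iff_eq_sq ?_ h0.le]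
    nlinarith
  unfold rhoThreshold
  rw [div_eq_iff hd]
  have e1 : -3 + x + Real.sqrt (-15 + x * (18 + x)) = (1 + a) * (2 * (x - 1)) ↔
      Real.sqrt (-15 + x * (18 + x)) = 2 * (x - 1) * a + (x + 1) := by
    constructor <;> intro h <;> linarith
  rw [e1, hs]
  have e2 : (2 * (x - 1) * a + (x + 1)) ^ 2 - (-15 + x * (18 + x)) =
    4 * (x - 1) * (a ^ 2 * (x - 1) + a * (x + 1) - 4) := by ring
  have hx1 : 4 * (x - 1) ≠ 0 := by positivity
  rw [eq_comm, ← sub_eq_zero, e2, mul_eq_zero, or_iff_right hx1]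

lemma one_lt_rhoBeat {x : ℝ} (hx : 1 < x) : 1 < rhoBeat x := by
  have h1 : 0 < -1 + x := by linarith
  unfold rhoBeat
  rw [lt_div_iff₀ (by positivity)]
  have : 2 * x - 1 < Real.sqrt ((1 - 2 * x) ^ 2 * (-3 + 4 * x)) := by
    apply Real.lt_sqrt_of_sq_lt
    nlinarith [sq_pos_of_pos (by linarith : (0:ℝ) < 2 * x - 1)]
  nlinarith

lemma rhoBeat_eq_rhoThreshold_iff {T : ℝ} (hT2 : 2 < T) (hT0 : polyTwo T = 0) {x : ℝ}
    (h2 : 2 < x) : rhoBeat x = rhoThreshold x ↔ x = T := by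
  have hx : 1 < x := by linarith
  have hd : 0 < x * (x ^ 2 - x + 1) := by nlinarith [mul_pos (by linarith : 0 < x) (by linarith : 0 < x - 1)]
  constructor
  · intro h
    obtain ⟨a, ha⟩ : ∃ a, rhoBeat x = 1 + a := ⟨rhoBeat x - 1, by ring⟩
    have ha0 : 0 < a := by have := one_lt_rhoBeat hx; linarith
    have hB := (rhoBeat_eq_iff hx ha0).1 ha
    have hT := (rhoThreshold_eq_iff hx ha0).1 (h ▸ ha)
    -- Both quadratics in `a` have proportional leading terms; eliminating `a ^ 2` determines `a`,
    -- and substituting it back gives `polyTwo`.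
    have hlin : a * (x * (x ^ 2 - x + 1)) = 4 * x - 1 := by linear_combination x ^ 2 * hT - hB
    have hW : polyTwo x = 0 := by
      have : (x * (x ^ 2 - x + 1)) ^ 2 * (a ^ 2 * (x - 1) + a * (x + 1) - 4) = 0 := by
        rw [hT, mul_zero]
      have e : (x * (x ^ 2 - x + 1)) ^ 2 * (a ^ 2 * (x - 1) + a * (x + 1) - 4) =
        (a * (x * (x ^ 2 - x + 1))) ^ 2 * (x - 1) + (a * (x * (x ^ 2 - x + 1))) *
          (x * (x ^ 2 - x + 1)) * (x + 1) - 4 * (x * (x ^ 2 - x + 1)) ^ 2 := by ring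
      rw [e, hlin] at this
      unfold polyTwo
      linear_combination this
    rcases lt_trichotomy x T with h | h | h
    · have := polyTwo_strictAnti h2.le h; linarith
    · exact h
    · have := polyTwo_strictAnti hT2.le h; linarith
  · rintro rfl
    set a := (4 * x - 1) / (x * (x ^ 2 - x + 1)) with ha
    have ha0 : 0 < a := div_pos (by linarith) hd
    have hlin : a * (x * (x ^ 2 - x + 1)) = 4 * x - 1 := div_mul_cancel₀ _ hd.ne'
    have hT : a ^ 2 * (x - 1) + a * (x + 1) - 4 = 0 := by
      have e : (x * (x ^ 2 - x + 1)) ^ 2 * (a ^ 2 * (x - 1) + a * (x + 1) - 4) =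
        (a * (x * (x ^ 2 - x + 1))) ^ 2 * (x - 1) + (a * (x * (x ^ 2 - x + 1))) *
          (x * (x ^ 2 - x + 1)) * (x + 1) - 4 * (x * (x ^ 2 - x + 1)) ^ 2 := by ring
      rw [hlin] at e
      have e2 : (x * (x ^ 2 - x + 1)) ^ 2 * (a ^ 2 * (x - 1) + a * (x + 1) - 4) = 0 := by
        rw [e]; unfold polyTwo at hT0; linear_combination hT0
      rcases mul_eq_zero.1 e2 with h | h
      · exact absurd h (by positivity)
      · exact h
    rw [(rhoThreshold_eq_iff hx ha0).2 hT, rhoBeat_eq_iff hx ha0]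
    linear_combination x ^ 2 * hT - hlin

/-! ### Worst-case cost of Threshold and Beat -/

section

variable {n : ℕ} (I : UniformInstance n)

/-- The jobs in `U` with processing time at most `E`. -/
noncomputable def UniformInstance.short (E : ℝ) (U : Finset (Fin n)) : Finset (Fin n) :=
  U.filter fun j => I.p j ≤ E

/-- The jobs in `U` with processing time greater than `E`. -/
noncomputable def UniformInstance.long (E : ℝ) (U : Finset (Fin n)) : Finset (Fin n) :=
  U.filter fun j => E < I.p j

variable {I}

lemma card_short_add_card_long (E : ℝ) (U : Finset (Fin n)) :
    ((I.short E U).card : ℝ) + (I.long E U).card = U.card := by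
  have h := Finset.card_filter_add_card_filter_not (s := U) (fun j => I.p j ≤ E)
  simp only [not_le] at h
  exact_mod_cast h

lemma sum_short_add_sum_long (E : ℝ) (U : Finset (Fin n)) (f : Fin n → ℝ) :
    ∑ i ∈ I.short E U, f i + ∑ i ∈ I.long E U, f i = ∑ i ∈ U, f i := by
  have h := Finset.sum_filter_add_sum_filter_not U (fun j => I.p j ≤ E) f
  simp only [not_le] at h
  exact h

lemma short_erase (E : ℝ) (U : Finset (Fin n)) (j : Fin n) :
    I.short E (U.erase j) = (I.short E U).erase j := Finset.filter_erase _ _ _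

lemma long_erase (E : ℝ) (U : Finset (Fin n)) (j : Fin n) :
    I.long E (U.erase j) = (I.long E U).erase j := Finset.filter_erase _ _ _

lemma cast_card_erase {U : Finset (Fin n)} {j : Fin n} (hj : j ∈ U) :
    ((U.erase j).card : ℝ) = U.card - 1 := by
  rw [Finset.card_erase_of_mem hj, Nat.cast_sub (Finset.card_pos.2 ⟨j, hj⟩)]; simp

lemma short_erase_of_lt {E : ℝ} {U : Finset (Fin n)} {j : Fin n} (h : E < I.p j) :
    I.short E (U.erase j) = I.short E U := by
  rw [short_erase, Finset.erase_eq_of_notMem]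
  simp [UniformInstance.short, h]

lemma long_erase_of_le {E : ℝ} {U : Finset (Fin n)} {j : Fin n} (h : I.p j ≤ E) :
    I.long E (U.erase j) = I.long E U := by
  rw [long_erase, Finset.erase_eq_of_notMem]
  simp [UniformInstance.long, h]

lemma costFrom_map_exec_of_sorted (l : List (Fin n)) : ∀ (t : ℝ) (D : Finset (Fin n)),
    l.Nodup → l.toFinset ⊆ D → l.Pairwise (fun i j => I.p i ≤ I.p j) →
    costFrom I t D (l.map Action.exec) =
      t * l.length + pairSum (fun i j => min (I.p i) (I.p j)) l.toFinset := by
  induction l with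
  | nil => intro t D _ _ _; simp [costFrom, pairSum_empty]
  | cons a l ih =>
    intro t D hl hD hs
    rw [List.nodup_cons] at hl
    rw [List.pairwise_cons] at hs
    have haD : a ∈ D := hD (by simp)
    have hlD : l.toFinset ⊆ D := fun x hx => hD (by simp at hx ⊢; exact Or.inr hx)
    have ha : a ∈ (a :: l).toFinset := by simp
    have he : (a :: l).toFinset.erase a = l.toFinset := by
      rw [List.toFinset_cons, Finset.erase_insert]
      simpa using hl.1
    have hsum : ∑ i ∈ (a :: l).toFinset, min (I.p i) (I.p a) = (l.length + 1) * I.p a := by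
      have hc : ∀ i ∈ (a :: l).toFinset, min (I.p i) (I.p a) = I.p a := by
        intro i hi
        simp only [List.toFinset_cons, Finset.mem_insert, List.mem_toFinset] at hi
        rcases hi with rfl | hi
        · exact min_self _
        · exact min_eq_right (hs.1 i hi)
      rw [Finset.sum_congr rfl hc, Finset.sum_const, nsmul_eq_mul,
        List.toFinset_card_of_nodup (List.nodup_cons.2 hl)]
      simp
    rw [pairSum_erase (fun i j => min_comm _ _) ha, he, hsum]
    simp only [List.map_cons, costFrom, haD, if_true, List.length_cons]
    rw [ih _ D hl.2 hlD hs.2]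
    push_cast
    ring

lemma costFrom_of_execSorted {P D : Finset (Fin n)} {s : List (Action n)} (h : ExecSorted I P s)
    (hP : P ⊆ D) (t : ℝ) :
    costFrom I t D s = t * P.card + pairSum (fun i j => min (I.p i) (I.p j)) P := by
  obtain ⟨l, hl, rfl, hs, rfl⟩ := h
  rw [costFrom_map_exec_of_sorted l t D hl hP hs, List.toFinset_card_of_nodup hl]

lemma card_mul_le_sum_max (R : Finset (Fin n)) (j : Fin n) :
    R.card * (1 + I.p j) ≤ ∑ i ∈ R, (1 + max (I.p i) (I.p j)) := by
  rw [← nsmul_eq_mul, ← Finset.sum_const]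
  exact Finset.sum_le_sum fun i _ => by gcongr; exact le_max_right _ _

/-- The summands are the delays short-short, short-long in both directions (a long test delays a
short job by `1`, a short job delays a long one by `1 + p i`), the long tests delaying deferred and
long jobs, and the final sorted executions. -/
lemma costFrom_le_of_thresholdFrom {U P : Finset (Fin n)} {s : List (Action n)}
    (h : ThresholdFrom I U P s) : ∀ (t : ℝ) (D : Finset (Fin n)), 0 ≤ t → P ⊆ D → Disjoint U P →
    costFrom I t D s ≤ t * (U.card + P.card) +
      pairSum (fun i j => 1 + max (I.p i) (I.p j)) (I.short 2 U) +
      ((I.short 2 U).card * (I.long 2 U).card +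
        (∑ i ∈ I.short 2 U, (1 + I.p i)) * (P.card + (I.long 2 U).card)) +
      (I.long 2 U).card * (P.card + (I.long 2 U).card) +
      pairSum (fun i j => min (I.p i) (I.p j)) (P ∪ I.long 2 U) := by
  induction h with
  | finish hs =>
    intro t D ht hP _
    rw [costFrom_of_execSorted hs hP]
    simp [UniformInstance.short, UniformInstance.long, pairSum_empty]
  | @testShort U P s j hj hshort hs ih =>
    intro t D ht hP hd
    have hjs : j ∈ I.short 2 U := by simp [UniformInstance.short, hj, hshort]
    have hpj := I.p_nonneg j
    have := ih (t + 1 + I.p j) (insert j D) (by linarith)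
      (hP.trans (Finset.subset_insert _ _)) (hd.mono_left (Finset.erase_subset _ _))
    rw [long_erase_of_le hshort, short_erase, cast_card_erase hj, cast_card_erase hjs] at this
    rw [pairSum_erase (fun i j => by rw [max_comm]) hjs,
      ← Finset.add_sum_erase _ (fun i => 1 + I.p i) hjs]
    have h1 := card_mul_le_sum_max (I := I) (I.short 2 U) j
    have h2 := card_short_add_card_long (I := I) 2 U
    simp only [costFrom, Finset.mem_insert_self, if_true]
    rw [← h2] at this ⊢
    linarith [Nat.cast_nonneg (α := ℝ) (I.long 2 U).card]
  | @testLong U P s j hj hlong hs ih =>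
    intro t D ht hP hd
    have hjl : j ∈ I.long 2 U := by simp [UniformInstance.long, hj, hlong]
    have hjP : j ∉ P := Finset.disjoint_left.1 hd hj
    have := ih (t + 1) (insert j D) (by linarith) (Finset.insert_subset_insert _ hP)
      (Finset.disjoint_left.2 fun x hx hx' => by
        rcases Finset.mem_insert.1 hx' with rfl | h
        · simp at hx
        · exact Finset.disjoint_left.1 hd (Finset.mem_of_mem_erase hx) h)
    have hu : insert j P ∪ (I.long 2 U).erase j = P ∪ I.long 2 U := by
      ext x
      by_cases hx : x = j
      · subst hx; simp [hjl]
      · simp [hx]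
    rw [short_erase_of_lt hlong, long_erase, hu, cast_card_erase hj, cast_card_erase hjl,
      Finset.card_insert_of_notMem hjP] at this
    push_cast at this
    have h2 := card_short_add_card_long (I := I) 2 U
    simp only [costFrom]
    rw [← h2] at this ⊢
    linarith

/-- Here `v = 1 / ub` and `z` is the final TotalTest. Executed deferred jobs have length between `1`
and `ub`, so their number lies between `v * te` and `te`; hence at most `z - v * te` long jobs
remain. Tests and executions of long jobs each delay that many; summing gives the two differences of
squares, integrals of `z - v * y` up to `z`. The added constants absorb rounding and the gap between
`tt` and `te`. -/
lemma costFrom_le_of_beatFrom {E v : ℝ} (hE : 1 ≤ E) (hE2 : 1 + E ≤ 2 * I.ub) (hub : 1 ≤ I.ub)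
    (hv : v * I.ub = 1) {U P : Finset (Fin n)} {tt te : ℝ} {s : List (Action n)}
    (h : BeatFrom I E U P tt te s) :
    ∀ (z t : ℝ) (D : Finset (Fin n)), 0 ≤ t → P ⊆ D → Disjoint U P → (∀ i ∈ P, 1 ≤ I.p i) →
    z = tt + (I.long E U).card → te ≤ tt → tt ≤ te + I.ub + 1 → 0 ≤ te →
    P.card ≤ tt - v * te → tt - P.card ≤ te →
    costFrom I t D s ≤ t * (U.card + P.card) +
      pairSum (fun i j => 1 + max (I.p i) (I.p j)) (I.short E U) +
      ((I.short E U).card * (2 * z - tt - te + I.ub + 1) +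
        (∑ i ∈ I.short E U, (1 + I.p i)) * (z - v * z)) +
      ((z - tt) * (z + 3) - v * (z ^ 2 - tt ^ 2) / 2) +
      ((z - te) * (z + 3) - v * (z ^ 2 - te ^ 2) / 2) +
      I.ub * ((z - v * z + 2) * (z - v * z + 3)) / 2 := by
  have hv0 : 0 < v := by
    by_contra hneg
    nlinarith
  have hv1 : v ≤ 1 := by nlinarith
  induction h with
  | @finish P tt te s hs =>
    intro z t D ht hP _ _ hz h1 h2 h3 h4 _
    rw [costFrom_of_execSorted hs hP]
    have hz : z = tt := by simpa [UniformInstance.long] using hz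
    subst hz
    have hm := pairSum_mono (m := fun i j => min (I.p i) (I.p j)) (m' := fun _ _ => I.ub) (R := P)
      (fun i _ j _ => (min_le_left _ _).trans (I.p_le i))
    rw [pairSum_const] at hm
    -- The excess over `z - v * z` is at most `v * (ub + 1) = 1 + v ≤ 2`.
    have hP2 : (P.card : ℝ) ≤ z - v * z + 2 := by
      have := mul_le_mul_of_nonneg_left h2 hv0.le
      nlinarith
    have hP0 : (0 : ℝ) ≤ P.card := Nat.cast_nonneg _
    have hPP : (P.card : ℝ) * (P.card + 1) ≤ (z - v * z + 2) * (z - v * z + 3) :=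
      mul_le_mul hP2 (by linarith) (by linarith) (by linarith)
    have hPP := mul_le_mul_of_nonneg_left hPP (zero_le_one.trans hub)
    -- The budget for executions that did not take place during testing is discarded.
    have hT : 0 ≤ (z - te) * (z + 3) - v * (z ^ 2 - te ^ 2) / 2 := by
      have e : (z - te) * (z + 3) - v * (z ^ 2 - te ^ 2) / 2 =
        (z - te) * ((1 - v) * z + v * (z - te) / 2 + 3) := by ring
      rw [e]
      have a1 : 0 ≤ z - te := by linarith
      have a2 : 0 ≤ 1 - v := by linarith
      have a3 : 0 ≤ z := by linarith
      positivity
    simp only [UniformInstance.short, pairSum_empty, Finset.filter_empty, Finset.card_empty,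
      Finset.sum_empty, Nat.cast_zero]
    linarith
  | @execLong U P tt te s k hU hk hmin hle hs ih =>
    intro z t D ht hP hd hP1 hz h1 h2 h3 h4 h5
    have hpk := I.p_nonneg k
    have hpk2 := I.p_le k
    have hvp : v * I.p k ≤ 1 := by nlinarith
    have hpk1 := hP1 k hk
    have := ih z (t + I.p k) D (by linarith) ((Finset.erase_subset _ _).trans hP)
      (hd.mono_right (Finset.erase_subset _ _))
      (fun i hi => hP1 i (Finset.mem_of_mem_erase hi)) hz hle (by linarith) (by linarith)
      (by rw [cast_card_erase hk]; linarith) (by rw [cast_card_erase hk]; linarith)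
    rw [cast_card_erase hk] at this
    have h6 := card_short_add_card_long (I := I) E U
    simp only [costFrom, hP hk, if_true]
    have h7 : I.p k * (P.card + (I.long E U).card) ≤
        I.p k * (z + 3) - v * ((te + I.p k) ^ 2 - te ^ 2) / 2 := by
      have := mul_le_mul_of_nonneg_left (show P.card + ((I.long E U).card : ℝ) ≤ z - v * te by
        linarith) hpk
      have := mul_le_mul_of_nonneg_left hvp hpk
      linarith
    rw [← h6] at this ⊢
    linarith
  | @testShort U P tt te s j hj hwait hshort hs ih =>
    intro z t D ht hP hd hP1 hz h1 h2 h3 h4 h5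
    have hjs : j ∈ I.short E U := by simp [UniformInstance.short, hj, hshort]
    have hpj := I.p_nonneg j
    have := ih z (t + 1 + I.p j) (insert j D) (by linarith)
      (hP.trans (Finset.subset_insert _ _)) (hd.mono_left (Finset.erase_subset _ _)) hP1
      (by rw [long_erase_of_le hshort]; exact hz) h1 h2 h3 h4 h5
    rw [short_erase, cast_card_erase hj, cast_card_erase hjs] at this
    rw [pairSum_erase (fun i j => by rw [max_comm]) hjs,
      ← Finset.add_sum_erase _ (fun i => 1 + I.p i) hjs]
    have h6 := card_mul_le_sum_max (I := I) (I.short E U) j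
    have h7 := card_short_add_card_long (I := I) E U
    simp only [costFrom, Finset.mem_insert_self, if_true]
    -- Testing a short job early delays more long jobs, but the extra `v * (1 + p j) * (z - te) ≤ 2
    -- * (z - te)` is covered by the waiting it avoids. This makes short jobs last the worst order.
    have h8 : (1 + I.p j) * (P.card + (I.long E U).card) ≤
        (2 * z - tt - te + I.ub + 1) + (1 + I.p j) * (z - v * z) := by
      have a1 : P.card + ((I.long E U).card : ℝ) ≤ z - v * te := by linarith
      have a2 := mul_le_mul_of_nonneg_left a1 (by linarith : 0 ≤ 1 + I.p j)
      have a3 : 0 ≤ z - te := by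
        have : (0 : ℝ) ≤ (I.long E U).card := Nat.cast_nonneg _
        linarith
      have a4 : (1 + I.p j) * v ≤ 2 := by nlinarith
      have a5 := mul_le_mul_of_nonneg_right a4 a3
      linarith
    rw [← h7] at this ⊢
    linarith
  | @testLong U P tt te s j hj hwait hlong hs ih =>
    intro z t D ht hP hd hP1 hz h1 h2 h3 h4 h5
    have hjl : j ∈ I.long E U := by simp [UniformInstance.long, hj, hlong]
    have hjP : j ∉ P := Finset.disjoint_left.1 hd hj
    have hcl : (1 : ℝ) ≤ (I.long E U).card := by exact_mod_cast Finset.card_pos.2 ⟨j, hjl⟩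
    -- Beat tests only when the shortest deferred job does not fit; with no deferred job, `tt -
    -- P.card ≤ te` gives the bound.
    have htt : tt ≤ te + I.ub := by
      rcases P.eq_empty_or_nonempty with rfl | ⟨i, hi⟩
      · simp at h5; linarith
      · have := hwait i hi; have := I.p_le i; linarith
    have := ih z (t + 1) (insert j D) (by linarith) (Finset.insert_subset_insert _ hP)
      (Finset.disjoint_left.2 fun x hx hx' => by
        rcases Finset.mem_insert.1 hx' with rfl | h
        · simp at hx
        · exact Finset.disjoint_left.1 hd (Finset.mem_of_mem_erase hx) h)
      (fun i hi => by
        rcases Finset.mem_insert.1 hi with rfl | h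
        · linarith
        · exact hP1 i h)
      (by rw [long_erase, cast_card_erase hjl]; linarith) (by linarith) (by linarith) h3
      (by rw [Finset.card_insert_of_notMem hjP]; push_cast; linarith)
      (by rw [Finset.card_insert_of_notMem hjP]; push_cast; linarith)
    rw [short_erase_of_lt hlong, cast_card_erase hj,
      Finset.card_insert_of_notMem hjP] at this
    push_cast at this
    have h6 := card_short_add_card_long (I := I) E U
    simp only [costFrom]
    have h7 : (P.card + ((I.long E U).card : ℝ)) ≤ (z + 3) - v * ((tt + 1) ^ 2 - tt ^ 2) / 2 := by
      have := mul_le_mul_of_nonneg_left htt hv0.le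
      nlinarith
    rw [← h6] at this ⊢
    linarith

end

/-! ### Comparison with the optimum: quadratic forms -/

section

variable {n : ℕ} {I : UniformInstance n}

lemma two_mul_pairSum_univ (E : ℝ) {m : Fin n → Fin n → ℝ} (hm : ∀ i j, m i j = m j i) :
    2 * pairSum m Finset.univ =
      (∑ i ∈ I.short E Finset.univ, ∑ j ∈ I.short E Finset.univ, m i j +
        ∑ i ∈ I.short E Finset.univ, m i i) +
      2 * ∑ i ∈ I.short E Finset.univ, ∑ j ∈ I.long E Finset.univ, m i j +
      (∑ i ∈ I.long E Finset.univ, ∑ j ∈ I.long E Finset.univ, m i j +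
        ∑ i ∈ I.long E Finset.univ, m i i) := by
  have h : ∀ f : Fin n → ℝ, ∑ i, f i =
      ∑ i ∈ I.short E Finset.univ, f i + ∑ i ∈ I.long E Finset.univ, f i :=
    fun f => (sum_short_add_sum_long E Finset.univ f).symm
  have hc : ∑ i ∈ I.long E Finset.univ, ∑ j ∈ I.short E Finset.univ, m i j =
      ∑ i ∈ I.short E Finset.univ, ∑ j ∈ I.long E Finset.univ, m i j := by
    rw [Finset.sum_comm]
    exact Finset.sum_congr rfl fun i _ => Finset.sum_congr rfl fun j _ => hm j i
  simp only [pairSum, h, Finset.sum_add_distrib, hc]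
  ring

/-- Write `max = p i + p j - min` and use `min ≥ p i * p j / E`, valid since both are at most `E`.
The double sum then factors, leaving only the cardinality and the sum of `p`. -/
lemma sum_sum_short_le {ι : Type*} (S : Finset ι) {p q : ι → ℝ} {E c R : ℝ} (hE : 0 < E)
    (hc : 0 ≤ c) (hR : 0 ≤ R) (hp : ∀ i ∈ S, 0 ≤ p i) (hpE : ∀ i ∈ S, p i ≤ E)
    (hq : ∀ i ∈ S, 1 + c * p i ≤ q i) :
    ∑ i ∈ S, ∑ j ∈ S, (1 + max (p i) (p j)) ≤ R * ∑ i ∈ S, ∑ j ∈ S, min (q i) (q j) +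
      ((1 - R) * S.card ^ 2 + 2 * S.card * ∑ i ∈ S, p i - (1 + R * c) / E * (∑ i ∈ S, p i) ^ 2) := by
  have key : ∀ i ∈ S, ∀ j ∈ S, 1 + max (p i) (p j) ≤
      R * min (q i) (q j) + ((1 - R) + (p i + p j) - (1 + R * c) / E * (p i * p j)) := by
    intro i hi j hj
    have h1 : 1 + c * min (p i) (p j) ≤ min (q i) (q j) :=
      le_min ((by gcongr; exact min_le_left _ _ : _ ≤ 1 + c * p i).trans (hq i hi))
        ((by gcongr; exact min_le_right _ _ : _ ≤ 1 + c * p j).trans (hq j hj))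
    have h2 : p i * p j / E ≤ min (p i) (p j) := by
      refine le_min ?_ ?_
      · rw [div_le_iff₀ hE]
        exact mul_le_mul_of_nonneg_left (hpE j hj) (hp i hi)
      · rw [div_le_iff₀ hE, mul_comm]
        exact mul_le_mul_of_nonneg_left (hpE i hi) (hp j hj)
    have h3 := max_add_min (p i) (p j)
    have h4 := mul_le_mul_of_nonneg_left h1 hR
    have h5 := mul_le_mul_of_nonneg_left h2 (by positivity : 0 ≤ 1 + R * c)
    have h6 : (1 + R * c) / E * (p i * p j) = (1 + R * c) * (p i * p j / E) := by ring
    rw [h6]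
    linarith
  have h := Finset.sum_le_sum fun i hi => Finset.sum_le_sum fun j hj => key i hi j hj
  refine h.trans_eq ?_
  simp only [Finset.sum_add_distrib, Finset.sum_sub_distrib, ← Finset.mul_sum, Finset.sum_const,
    nsmul_eq_mul, ← Finset.sum_mul]
  ring

/-- The offline time is monotone in `p`, so in a short-long pair the short job attains the minimum.
-/
lemma sum_short_mul_card_le {E : ℝ} :
    (I.long E Finset.univ).card * ∑ i ∈ I.short E Finset.univ, I.offline i ≤
    ∑ i ∈ I.short E Finset.univ, ∑ j ∈ I.long E Finset.univ,
      min (I.offline i) (I.offline j) := by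
  rw [Finset.mul_sum]
  refine Finset.sum_le_sum fun i hi => ?_
  rw [← nsmul_eq_mul, ← Finset.sum_const]
  refine Finset.sum_le_sum fun j hj => le_min le_rfl ?_
  simp only [UniformInstance.short, UniformInstance.long, Finset.mem_filter] at hi hj
  exact min_le_min le_rfl (by linarith)

lemma sum_short_offline_ge {E c : ℝ} (h : ∀ i ∈ I.short E Finset.univ, 1 + c * I.p i ≤ I.offline i) :
    (I.short E Finset.univ).card + c * ∑ i ∈ I.short E Finset.univ, I.p i ≤
      ∑ i ∈ I.short E Finset.univ, I.offline i := by
  have := Finset.sum_le_sum h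
  simpa [Finset.sum_add_distrib, ← Finset.mul_sum] using this

/-- `R` and the slope `647375 / 1000000` are replaced by numerical bounds; the remaining form is
negative by two completed squares, first in `S`, then in `k`. -/
lemma threshold_quadratic_nonpos {R k S z : ℝ} (hR : 193375 / 100000 < R) (hk : 0 ≤ k)
    (hz : 0 ≤ z) :
    (1 - R) * k ^ 2 + 2 * k * S - (1 + R * (647375 / 1000000)) / 2 * S ^ 2 +
      2 * (2 - R) * k * z - 1427 / 10000 * z ^ 2 ≤ 0 := by
  have h1 : (1 - R) * k ^ 2 ≤ -(93375 / 100000) * k ^ 2 := by gcongr; linarith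
  have h2 : 11259 / 10000 * S ^ 2 ≤ (1 + R * (647375 / 1000000)) / 2 * S ^ 2 :=
    mul_le_mul_of_nonneg_right (by linarith) (sq_nonneg S)
  have h3 : 2 * (2 - R) * k * z ≤ 2 * (6625 / 100000) * k * z := by gcongr; linarith
  nlinarith [sq_nonneg (11259 / 10000 * S - k), sq_nonneg (k - 145 / 100 * z), sq_nonneg z,
    sq_nonneg k]

lemma cost_le_of_thresholdFrom {R : ℝ} (hR : 193375 / 100000 < R)
    (hub : 229475 / 100000 < I.ub) {s : List (Action n)}
    (h : ThresholdFrom I Finset.univ ∅ s) : cost I s ≤ R * opt I := by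
  have hcost := costFrom_le_of_thresholdFrom h 0 ∅ le_rfl (Finset.Subset.refl _)
    (Finset.disjoint_empty_right _)
  have hopt := mul_le_mul_of_nonneg_left (pairSum_offline_le_opt I) (by linarith : 0 ≤ R)
  have hsplit := congrArg (R * ·) (two_mul_pairSum_univ (I := I) 2
    (m := fun i j => min (I.offline i) (I.offline j)) (fun i j => min_comm _ _))
  -- The slope is that of the chord from `(0, 1)` to `(2, 2.29475)`, which lies below the concave
  -- function `min ub (1 + p)` on `[0, 2]`.
  have hq : ∀ i ∈ I.short 2 Finset.univ, 1 + 647375 / 1000000 * I.p i ≤ I.offline i := by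
    intro i hi
    simp only [UniformInstance.short, Finset.mem_filter] at hi
    have := I.p_nonneg i
    exact le_min (by linarith) (by linarith)
  have hSS := sum_sum_short_le (I.short 2 Finset.univ) (p := I.p) (q := I.offline) (R := R)
    (by norm_num) (by norm_num) (by linarith) (fun i _ => I.p_nonneg i)
    (fun i hi => (Finset.mem_filter.1 hi).2) hq
  have hSL := mul_le_mul_of_nonneg_left (sum_short_mul_card_le (I := I) (E := 2))
    (by linarith : 0 ≤ R)
  have hS := sum_short_offline_ge hq
  have hSd : ∑ i ∈ I.short 2 Finset.univ, (1 + I.p i) ≤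
      R * ∑ i ∈ I.short 2 Finset.univ, I.offline i := by
    rw [Finset.mul_sum]
    refine Finset.sum_le_sum fun i hi => ?_
    have := hq i hi
    have hp2 : I.p i ≤ 2 := (Finset.mem_filter.1 hi).2
    have := I.p_nonneg i
    nlinarith
  have hLd : ∑ i ∈ I.long 2 Finset.univ, I.p i ≤ R * ∑ i ∈ I.long 2 Finset.univ, I.offline i := by
    rw [Finset.mul_sum]
    refine Finset.sum_le_sum fun i hi => ?_
    have h1 : I.p i ≤ I.offline i := le_min (I.p_le i) (by linarith)
    have := I.p_nonneg i
    nlinarith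
  -- The critical case is `q = ub`, where `(R - 1) * ub > 0.93375 * 2.29475 > 2.1427`; the `2` pays
  -- for the long tests.
  have hLL : ∑ i ∈ I.long 2 Finset.univ, ∑ j ∈ I.long 2 Finset.univ, min (I.p i) (I.p j) +
      (2 + 1427 / 10000) * (I.long 2 Finset.univ).card ^ 2 ≤
      R * ∑ i ∈ I.long 2 Finset.univ, ∑ j ∈ I.long 2 Finset.univ,
        min (I.offline i) (I.offline j) := by
    have key : ∀ i ∈ I.long 2 Finset.univ, ∀ j ∈ I.long 2 Finset.univ,
        min (I.p i) (I.p j) + (2 + 1427 / 10000) ≤ R * min (I.offline i) (I.offline j) := by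
      intro i hi j hj
      have hi2 : 2 < I.p i := (Finset.mem_filter.1 hi).2
      have hj2 : 2 < I.p j := (Finset.mem_filter.1 hj).2
      have e : min (I.offline i) (I.offline j) = min I.ub (1 + min (I.p i) (I.p j)) := by
        rw [UniformInstance.offline, UniformInstance.offline, ← min_add_add_left, min_min_min_comm,
          min_self]
      have h2 : 2 < min (I.p i) (I.p j) := lt_min hi2 hj2
      have h3 : min (I.p i) (I.p j) ≤ I.ub := (min_le_left _ _).trans (I.p_le i)
      rw [e]
      rcases min_choice I.ub (1 + min (I.p i) (I.p j)) with h | h <;> rw [h] <;> nlinarith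
    have h := Finset.sum_le_sum fun i hi => Finset.sum_le_sum fun j hj => key i hi j hj
    simp only [Finset.sum_add_distrib, ← Finset.mul_sum, Finset.sum_const, nsmul_eq_mul] at h
    linarith
  have hquad := threshold_quadratic_nonpos (R := R) (k := (I.short 2 Finset.univ).card)
    (S := ∑ i ∈ I.short 2 Finset.univ, I.p i) (z := (I.long 2 Finset.univ).card) hR
    (Nat.cast_nonneg _) (Nat.cast_nonneg _)
  have hcross := mul_le_mul_of_nonneg_left hS (by positivity :
    0 ≤ R * ((I.long 2 Finset.univ).card : ℝ))
  have hcross2 : 0 ≤ ((I.long 2 Finset.univ).card : ℝ) *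
      ((R * (647375 / 1000000) - 1) * ∑ i ∈ I.short 2 Finset.univ, I.p i) :=
    mul_nonneg (Nat.cast_nonneg _) (mul_nonneg (by linarith)
      (Finset.sum_nonneg fun i _ => I.p_nonneg i))
  have hW : ∑ i ∈ I.short 2 Finset.univ, (1 + I.p i) =
      (I.short 2 Finset.univ).card + ∑ i ∈ I.short 2 Finset.univ, I.p i := by
    simp [Finset.sum_add_distrib]
  simp only [zero_mul, zero_add, Finset.card_empty, Nat.cast_zero, Finset.empty_union] at hcost
  simp only [pairSum, max_self, min_self] at hcost hsplit hopt
  rw [hW] at hcost hSd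
  unfold cost
  linarith

/-- At `x = T` the expression is `polyOne T = 0`. Its difference from `polyOne T` has only
nonnegative coefficients in the shifts `w` and `u`. -/
lemma beat_polynomial_nonneg {T x : ℝ} (hT : 193375 / 100000 < T) (hT0 : polyOne T = 0)
    (hx : T ≤ x) :
    0 ≤ (T - 1) ^ 2 * (x - 1) * x ^ 2 + (T - 1) * x * (2 * x - 1) - (2 * x - 1) ^ 2 := by
  obtain ⟨w, rfl⟩ : ∃ w, T = 193375 / 100000 + w := ⟨T - 193375 / 100000, by ring⟩
  obtain ⟨u, rfl⟩ : ∃ u, x = 193375 / 100000 + w + u := ⟨x - (193375 / 100000 + w), by ring⟩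
  have hw : 0 ≤ w := by linarith
  have hu : 0 ≤ u := by linarith
  rw [← hT0, ← sub_nonneg]
  unfold polyOne
  ring_nf
  positivity

/-- Multiply by `T - 1` and complete the square in `k`. The coefficients left for `S ^ 2` and `z *
S` have room to spare; the one for `z ^ 2` is `beat_polynomial_nonneg` divided by `x ^ 2`, tight at
`x = T`. -/
lemma beat_quadratic_nonpos {T x v E c k S z : ℝ} (hT : 193375 / 100000 < T)
    (hT2 : T < 193385 / 100000) (hT0 : polyOne T = 0) (hx : T ≤ x) (hx2 : x < 229485 / 100000)
    (hv : v * x = 1) (hE : E = max 1 (x - 1)) (hc : c = min 1 (x - 1)) (hS : 0 ≤ S)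
    (hz : 0 ≤ z) :
    (1 - T) * k ^ 2 + 2 * k * S - (1 + T * c) / E * S ^ 2 +
      2 * z * ((3 - v - T) * k - (T * c - 1 + v) * S) - ((T - 1) * x - 2 + v) * z ^ 2 ≤ 0 := by
  have hx0 : 0 < x := by linarith
  have hE0 : 0 < E := hE ▸ lt_of_lt_of_le one_pos (le_max_left _ _)
  have hc1 : 93 / 100 ≤ c := hc ▸ le_min (by norm_num) (by linarith)
  have hE2 : E ≤ 13 / 10 := hE ▸ max_le (by norm_num) (by linarith)
  have hTc : 193 / 100 * (93 / 100) ≤ T * c := mul_le_mul (by linarith) hc1 (by norm_num)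
    (by linarith)
  have hv1 : 43 / 100 ≤ v := by nlinarith
  have h1 : 1 ≤ (T - 1) * ((1 + T * c) / E) := by
    rw [← mul_div_assoc, le_div_iff₀ hE0]
    nlinarith
  have h2 : 3 - v - T ≤ (T - 1) * (T * c - 1 + v) := by nlinarith
  have h3 : (3 - v - T) ^ 2 ≤ (T - 1) * ((T - 1) * x - 2 + v) := by
    have hp := beat_polynomial_nonneg hT hT0 hx
    have e : (T - 1) ^ 2 * (x - 1) * x ^ 2 + (T - 1) * x * (2 * x - 1) - (2 * x - 1) ^ 2 =
        x ^ 2 * ((T - 1) * ((T - 1) * x - 2 + v) - (3 - v - T) ^ 2) := by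
      have hv' : v = x⁻¹ := eq_inv_of_mul_eq_one_left hv
      subst hv'
      field_simp
      ring
    rw [e] at hp
    have := nonneg_of_mul_nonneg_right hp (by positivity)
    linarith
  have e : (T - 1) * ((1 - T) * k ^ 2 + 2 * k * S - (1 + T * c) / E * S ^ 2 +
      2 * z * ((3 - v - T) * k - (T * c - 1 + v) * S) - ((T - 1) * x - 2 + v) * z ^ 2) =
      -((T - 1) * k - S - (3 - v - T) * z) ^ 2 - ((T - 1) * ((1 + T * c) / E) - 1) * S ^ 2 -
      2 * (z * S) * ((T - 1) * (T * c - 1 + v) - (3 - v - T)) -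
      ((T - 1) * ((T - 1) * x - 2 + v) - (3 - v - T) ^ 2) * z ^ 2 := by ring
  have a1 := mul_nonneg (sub_nonneg.2 h1) (sq_nonneg S)
  have a2 := mul_nonneg (mul_nonneg zero_le_two (mul_nonneg hz hS)) (sub_nonneg.2 h2)
  have a3 := mul_nonneg (sub_nonneg.2 h3) (sq_nonneg z)
  refine nonpos_of_mul_nonpos_right (a := T - 1) ?_ (by linarith)
  rw [e]
  nlinarith [sq_nonneg ((T - 1) * k - S - (3 - v - T) * z)]

lemma cost_le_of_beatRun {T : ℝ} (hT : 193375 / 100000 < T) (hT2 : T < 193385 / 100000)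
    (hT0 : polyOne T = 0) (hx : T ≤ I.ub) (hx2 : I.ub < 229485 / 100000) (hn : 0 < n)
    {s : List (Action n)} (h : BeatRun I s) : cost I s ≤ T * opt I + 25 * n := by
  obtain ⟨E, hE⟩ : ∃ E, E = max 1 (I.ub - 1) := ⟨_, rfl⟩
  obtain ⟨c, hc⟩ : ∃ c, c = min 1 (I.ub - 1) := ⟨_, rfl⟩
  obtain ⟨v, hv⟩ : ∃ v, v * I.ub = 1 := ⟨I.ub⁻¹, inv_mul_cancel₀ I.ub_pos.ne'⟩
  rw [BeatRun, ← hE] at h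
  have hE1 : 1 ≤ E := hE ▸ le_max_left _ _
  have hE2 : E ≤ 13 / 10 := hE ▸ max_le (by norm_num) (by linarith)
  have hc0 : 93 / 100 ≤ c := hc ▸ le_min (by norm_num) (by linarith)
  -- In both cases `c * E = ub - 1`, so `1 + c * p` reaches at most `ub` on `[0, E]`.
  have hcE : c * E ≤ I.ub - 1 := by
    rw [hc, hE]
    rcases le_total 1 (I.ub - 1) with h | h <;> simp [h]
  have hc1 : c ≤ 1 := hc ▸ min_le_left _ _
  have hcost := costFrom_le_of_beatFrom hE1 (by linarith) (by linarith) hv h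
    (I.long E Finset.univ).card 0 ∅ le_rfl (Finset.Subset.refl _)
    (Finset.disjoint_empty_right _) (by simp) (by simp) le_rfl (by linarith) le_rfl
    (by simp) (by simp)
  have hopt := mul_le_mul_of_nonneg_left (pairSum_offline_le_opt I) (by linarith : 0 ≤ T)
  have hsplit := congrArg (T * ·) (two_mul_pairSum_univ (I := I) E
    (m := fun i j => min (I.offline i) (I.offline j)) (fun i j => min_comm _ _))
  have hpE : ∀ i ∈ I.short E Finset.univ, I.p i ≤ E := fun i hi => (Finset.mem_filter.1 hi).2
  have hq : ∀ i ∈ I.short E Finset.univ, 1 + c * I.p i ≤ I.offline i := by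
    intro i hi
    have h1 := hpE i hi
    have h2 := I.p_nonneg i
    have h3 : c * I.p i ≤ c * E := by gcongr
    exact le_min (by linarith) (by nlinarith)
  have hqL : ∀ i ∈ I.long E Finset.univ, I.offline i = I.ub := by
    intro i hi
    have h1 : E < I.p i := (Finset.mem_filter.1 hi).2
    have h2 : I.ub - 1 ≤ E := hE ▸ le_max_right _ _
    exact min_eq_left (by linarith)
  have hLL : ∑ i ∈ I.long E Finset.univ, ∑ j ∈ I.long E Finset.univ,
      min (I.offline i) (I.offline j) = I.ub * (I.long E Finset.univ).card ^ 2 := by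
    rw [Finset.sum_congr rfl fun i hi => Finset.sum_congr rfl fun j hj => by
      rw [hqL i hi, hqL j hj]]
    simp
    ring
  have hSS := sum_sum_short_le (I.short E Finset.univ) (p := I.p) (q := I.offline) (R := T)
    (by linarith) (by linarith) (by linarith) (fun i _ => I.p_nonneg i) hpE hq
  have hSL := mul_le_mul_of_nonneg_left (sum_short_mul_card_le (I := I) (E := E))
    (by linarith : 0 ≤ T)
  have hS := sum_short_offline_ge hq
  have hq0 : ∀ i, 0 ≤ I.offline i := fun i =>
    le_min I.ub_pos.le (by have := I.p_nonneg i; linarith)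
  have hd1 : 0 ≤ T * ∑ i ∈ I.short E Finset.univ, I.offline i :=
    mul_nonneg (by linarith) (Finset.sum_nonneg fun i _ => hq0 i)
  have hd2 : 0 ≤ T * ∑ i ∈ I.long E Finset.univ, I.offline i :=
    mul_nonneg (by linarith) (Finset.sum_nonneg fun i _ => hq0 i)
  have hS0 : 0 ≤ ∑ i ∈ I.short E Finset.univ, I.p i := Finset.sum_nonneg fun i _ => I.p_nonneg i
  have hS1 : ∑ i ∈ I.short E Finset.univ, I.p i ≤ 13 / 10 * (I.short E Finset.univ).card := by
    have := Finset.sum_le_sum fun i hi => (hpE i hi).trans hE2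
    rw [Finset.sum_const, nsmul_eq_mul] at this
    linarith
  have hW : ∑ i ∈ I.short E Finset.univ, (1 + I.p i) =
      (I.short E Finset.univ).card + ∑ i ∈ I.short E Finset.univ, I.p i := by
    simp [Finset.sum_add_distrib]
  have hcard := card_short_add_card_long (I := I) E Finset.univ
  have hquad := beat_quadratic_nonpos (k := (I.short E Finset.univ).card)
    (S := ∑ i ∈ I.short E Finset.univ, I.p i) (z := (I.long E Finset.univ).card) hT hT2 hT0 hx hx2
    hv hE hc hS0 (Nat.cast_nonneg _)
  have hcross := mul_le_mul_of_nonneg_left hS (by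
    have : 0 ≤ T := by linarith
    positivity : 0 ≤ T * ((I.long E Finset.univ).card : ℝ))
  have hn1 : (1 : ℝ) ≤ n := by exact_mod_cast hn
  simp only [zero_mul, zero_add, Finset.card_empty, Nat.cast_zero, add_zero, sub_zero] at hcost
  simp only [pairSum, max_self, min_self, hLL] at hcost hsplit hopt
  rw [hW] at hcost
  rw [Finset.card_univ, Fintype.card_fin] at hcard
  unfold cost
  have hk : (0 : ℝ) ≤ (I.short E Finset.univ).card := Nat.cast_nonneg _
  have hz : (0 : ℝ) ≤ (I.long E Finset.univ).card := Nat.cast_nonneg _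
  generalize ((I.short E Finset.univ).card : ℝ) = k at *
  generalize ((I.long E Finset.univ).card : ℝ) = z at *
  generalize (∑ i ∈ I.short E Finset.univ, I.p i) = S at *
  -- From `v * ub = 1`, `ub * (1 - v) ^ 2 = ub - 2 + v`.
  have e : I.ub * ((z - v * z + 2) * (z - v * z + 3)) / 2 =
      ((I.ub - 2 + v) * z ^ 2 + 5 * (I.ub - 1) * z + 6 * I.ub) / 2 := by
    linear_combination ((-2 + v) * z ^ 2 - 5 * z) / 2 * hv
  have hlin : 5 * (I.ub - 1) * z ≤ 5 * (13 / 10) * z := by gcongr; linarith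
  have hlin2 : k * I.ub ≤ k * (23 / 10) := by gcongr; linarith
  rw [e] at hcost
  linarith

end

/-! ### Existence: an implementation as a state machine -/

section

/-- The internal state of an implementation of Beat or Threshold: the untested jobs `U`, the
deferred jobs `P` and their processing times `v`, the values `tt`, `te` of TotalTest and TotalExec,
and the job `cur` that has to be executed immediately, if any. -/
structure MachineState (n : ℕ) where
  U : Finset (Fin n)
  P : Finset (Fin n)
  v : Fin n → ℝ
  tt : ℝ
  te : ℝ
  cur : Option (Fin n)

/-- The state before the first operation. -/
def MachineState.init (n : ℕ) : MachineState n := ⟨Finset.univ, ∅, 0, 0, 0, none⟩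

/-- The state after one more observation, when `E` is the bound for short jobs. -/
noncomputable def MachineState.step {n : ℕ} (E : ℝ) (st : MachineState n) :
    Action n × Option ℝ → MachineState n
  | (Action.test j, some x) =>
      if x ≤ E then { st with U := st.U.erase j, cur := some j }
      else { st with
        U := st.U.erase j, P := insert j st.P, v := Function.update st.v j x, tt := st.tt + 1 }
  | (Action.test _, none) => st
  | (Action.exec j, _) =>
      match st.cur with
      | some _ => { st with cur := none }
      | none => { st with P := st.P.erase j, te := st.te + st.v j }

open Classical in
/-- The next operation. Deferred jobs are executed during the testing phase only if `b` holds. -/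
noncomputable def MachineState.next {n : ℕ} (b : Prop) (st : MachineState n) : Option (Action n) :=
  match st.cur with
  | some j => some (Action.exec j)
  | none =>
      if hU : st.U.Nonempty then
        if h : b ∧ ∃ k ∈ st.P, (∀ i ∈ st.P, st.v k ≤ st.v i) ∧ st.te + st.v k ≤ st.tt then
          some (Action.exec h.2.choose)
        else some (Action.test hU.choose)
      else if h : ∃ k ∈ st.P, ∀ i ∈ st.P, st.v k ≤ st.v i then some (Action.exec h.choose)
      else none

/-- The state after the observations `o`. -/
noncomputable def MachineState.after {n : ℕ} (E : ℝ) (o : List (Action n × Option ℝ)) :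
    MachineState n :=
  o.foldl (MachineState.step E) (MachineState.init n)

open Classical in
/-- The next operation when all jobs are executed untested. -/
noncomputable def untestedNext {n : ℕ} (o : List (Action n × Option ℝ)) : Option (Action n) :=
  if h : ∃ j, Action.exec j ∉ o.map Prod.fst then some (Action.exec h.choose) else none

/-- The combined algorithm with switching points `T₁` and `T₂`. -/
noncomputable def combined (T₁ T₂ : ℝ) : OnlineAlgorithm := fun _ ub o =>
  if ub < T₁ then untestedNext o
  else if ub ≤ T₂ then (MachineState.after (max 1 (ub - 1)) o).next True
  else (MachineState.after 2 o).next False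

variable {n : ℕ} {I : UniformInstance n} {A : OnlineAlgorithm}

lemma runFrom_succ_of_some {s : List (Action n)} {a : Action n}
    (h : A n I.ub (observe I s) = some a) (m : ℕ) :
    A.runFrom I (m + 1) s = A.runFrom I m (s ++ [a]) := by
  simp [OnlineAlgorithm.runFrom, h]

lemma runFrom_of_none {s : List (Action n)} (h : A n I.ub (observe I s) = none) (m : ℕ) :
    A.runFrom I m s = s := by
  cases m <;> simp [OnlineAlgorithm.runFrom, h]

lemma exists_runFrom_cons {s : List (Action n)} {a : Action n} {m : ℕ} {Q : List (Action n) → Prop}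
    (h : A n I.ub (observe I s) = some a)
    (hQ : ∃ r, A.runFrom I m (s ++ [a]) = (s ++ [a]) ++ r ∧ Q (a :: r)) :
    ∃ r, A.runFrom I (m + 1) s = s ++ r ∧ Q r := by
  obtain ⟨r, hr, hq⟩ := hQ
  exact ⟨a :: r, by rw [runFrom_succ_of_some h, hr]; simp, hq⟩

lemma runFrom_untested (hA : ∀ s, A n I.ub (observe I s) = untestedNext (observe I s)) (m : ℕ) :
    ∀ (R : Finset (Fin n)) (s : List (Action n)), (∀ j, j ∈ R ↔ Action.exec j ∉ s) → R.card ≤ m →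
      ∃ l : List (Fin n), l.Nodup ∧ (∀ j, j ∈ l ↔ j ∈ R) ∧
        A.runFrom I m s = s ++ l.map Action.exec := by
  have hfst : ∀ s, (observe I s).map Prod.fst = s := by
    intro s
    rw [observe, List.map_map]
    conv_rhs => rw [← List.map_id s]
    refine List.map_congr_left fun a _ => ?_
    cases a <;> rfl
  have hmem : ∀ s a, a ∈ (observe I s).map Prod.fst ↔ a ∈ s := fun s a => by rw [hfst]
  induction m with
  | zero =>
    intro R s _ hm
    have : R = ∅ := Finset.card_eq_zero.1 (Nat.le_zero.1 hm)
    subst this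
    exact ⟨[], by simp, by simp, by simp [OnlineAlgorithm.runFrom]⟩
  | succ m ih =>
    intro R s hR hm
    by_cases h : ∃ j, Action.exec j ∉ (observe I s).map Prod.fst
    · have hk : h.choose ∈ R := by
        have := h.choose_spec
        exact (hR _).2 fun hm => this ((hmem s _).2 hm)
      have hs : A n I.ub (observe I s) = some (Action.exec h.choose) := by
        rw [hA, untestedNext, dif_pos h]
      generalize h.choose = k at hk hs
      obtain ⟨l, hl, hlR, hr⟩ := ih (R.erase k) (s ++ [Action.exec k])
        (fun j => by simp [hR j, and_comm]) (by rw [Finset.card_erase_of_mem hk]; omega)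
      refine ⟨k :: l, List.nodup_cons.2 ⟨fun hk' => by simpa using (hlR k).1 hk', hl⟩, ?_, ?_⟩
      · intro j
        rw [List.mem_cons, hlR, Finset.mem_erase]
        by_cases hj : j = k
        · simp [hj, hk]
        · simp [hj]
      · rw [runFrom_succ_of_some hs, hr]
        simp
    · have hs : A n I.ub (observe I s) = none := by rw [hA, untestedNext, dif_neg h]
      refine ⟨[], by simp, ?_, by rw [runFrom_of_none hs]; simp⟩
      intro j
      rw [hfst] at h
      push Not at h
      simp [hR j, h j]

lemma untestedRun_schedule (hA : ∀ s, A n I.ub (observe I s) = untestedNext (observe I s)) :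
    UntestedRun (A.schedule I) := by
  obtain ⟨l, hl, hm, hr⟩ := runFrom_untested hA (2 * n) Finset.univ [] (by simp) (by simp; omega)
  exact ⟨l, hl, fun j => by simp [hm], by simpa [OnlineAlgorithm.schedule] using hr⟩

lemma execSorted_cons {P : Finset (Fin n)} {k : Fin n} {s : List (Action n)} (hk : k ∈ P)
    (hmin : ∀ i ∈ P, I.p k ≤ I.p i) (hs : ExecSorted I (P.erase k) s) :
    ExecSorted I P (Action.exec k :: s) := by
  obtain ⟨l, hl, hP, hp, rfl⟩ := hs
  have hmem : ∀ i, i ∈ l ↔ i ∈ P.erase k := fun i => by rw [← hP, List.mem_toFinset]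
  refine ⟨k :: l, List.nodup_cons.2 ⟨fun h => by simpa using (hmem k).1 h, hl⟩, ?_, ?_, rfl⟩
  · rw [List.toFinset_cons, hP, Finset.insert_erase hk]
  · exact List.pairwise_cons.2 ⟨fun i hi => hmin i (Finset.mem_of_mem_erase ((hmem i).1 hi)), hp⟩

lemma after_observe_append (E : ℝ) (s : List (Action n)) (a : Action n) :
    MachineState.after E (observe I (s ++ [a])) =
      (MachineState.after E (observe I s)).step E
        (match a with
          | Action.test j => (Action.test j, some (I.p j))
          | Action.exec j => (Action.exec j, none)) := by
  simp only [MachineState.after, observe, List.map_append, List.foldl_append]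
  rfl

variable {E : ℝ} {b : Prop}

lemma runFrom_finish
    (hA : ∀ s, A n I.ub (observe I s) = (MachineState.after E (observe I s)).next b) (m : ℕ) :
    ∀ (P : Finset (Fin n)) (v : Fin n → ℝ) (tt te : ℝ) (s : List (Action n)),
      MachineState.after E (observe I s) = ⟨∅, P, v, tt, te, none⟩ → (∀ i ∈ P, v i = I.p i) →
      P.card ≤ m → ∃ r, A.runFrom I m s = s ++ r ∧ ExecSorted I P r := by
  induction m with
  | zero =>
    intro P v tt te s _ _ hm
    have : P = ∅ := Finset.card_eq_zero.1 (Nat.le_zero.1 hm)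
    subst this
    exact ⟨[], by simp [OnlineAlgorithm.runFrom], [], by simp⟩
  | succ m ih =>
    intro P v tt te s hst hv hm
    by_cases h : ∃ k ∈ P, ∀ i ∈ P, v k ≤ v i
    · have hs : A n I.ub (observe I s) = some (Action.exec h.choose) := by
        rw [hA, hst]
        simp [MachineState.next, h]
      obtain ⟨hk, hmin⟩ := h.choose_spec
      generalize h.choose = k at hs hk hmin
      refine exists_runFrom_cons hs ?_
      obtain ⟨r, hr, hq⟩ := ih (P.erase k) v tt (te + v k) (s ++ [Action.exec k])
        (by rw [after_observe_append, hst]; rfl) (fun i hi => hv i (Finset.mem_of_mem_erase hi))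
        (by rw [Finset.card_erase_of_mem hk]; omega)
      refine ⟨r, hr, execSorted_cons hk (fun i hi => ?_) hq⟩
      rw [← hv k hk, ← hv i hi]
      exact hmin i hi
    · have hP : P = ∅ := by
        by_contra hne
        exact h (Finset.exists_min_image P v (Finset.nonempty_iff_ne_empty.2 hne))
      subst hP
      have hs : A n I.ub (observe I s) = none := by
        rw [hA, hst]
        simp [MachineState.next]
      exact ⟨[], by rw [runFrom_of_none hs]; simp, [], by simp⟩

/-- The schedules of the implementation satisfy every relation that is closed under the rules of
the algorithm. -/
lemma runFrom_machine
    (hA : ∀ s, A n I.ub (observe I s) = (MachineState.after E (observe I s)).next b)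
    {Q : Finset (Fin n) → Finset (Fin n) → ℝ → ℝ → List (Action n) → Prop}
    (finish : ∀ P tt te s, ExecSorted I P s → Q ∅ P tt te s)
    (execLong : ∀ U P tt te s k, b → U.Nonempty → k ∈ P → (∀ i ∈ P, I.p k ≤ I.p i) →
      te + I.p k ≤ tt → Q U (P.erase k) tt (te + I.p k) s → Q U P tt te (Action.exec k :: s))
    (testShort : ∀ U P tt te s j, j ∈ U → (b → ∀ i ∈ P, tt < te + I.p i) → I.p j ≤ E →
      Q (U.erase j) P tt te s → Q U P tt te (Action.test j :: Action.exec j :: s))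
    (testLong : ∀ U P tt te s j, j ∈ U → (b → ∀ i ∈ P, tt < te + I.p i) → E < I.p j →
      Q (U.erase j) (insert j P) (tt + 1) te s → Q U P tt te (Action.test j :: s)) (m : ℕ) :
    ∀ (U P : Finset (Fin n)) (v : Fin n → ℝ) (tt te : ℝ) (s : List (Action n)),
      MachineState.after E (observe I s) = ⟨U, P, v, tt, te, none⟩ → (∀ i ∈ P, v i = I.p i) →
      2 * U.card + P.card ≤ m → ∃ r, A.runFrom I m s = s ++ r ∧ Q U P tt te r := by
  induction m using Nat.strong_induction_on with
  | _ m ih =>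
  intro U P v tt te s hst hv hm
  rcases U.eq_empty_or_nonempty with rfl | hU
  · obtain ⟨r, hr, hs⟩ := runFrom_finish hA m P v tt te s hst hv (by omega)
    exact ⟨r, hr, finish P tt te r hs⟩
  have hU1 : 1 ≤ U.card := hU.card_pos
  -- An untested job reserves two operations, so a short job can be tested and executed within the
  -- remaining budget.
  obtain ⟨m, rfl⟩ : ∃ m', m = m' + 1 + 1 := ⟨m - 2, by omega⟩
  by_cases h : b ∧ ∃ k ∈ P, (∀ i ∈ P, v k ≤ v i) ∧ te + v k ≤ tt
  · have hs : A n I.ub (observe I s) = some (Action.exec h.2.choose) := by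
      rw [hA, hst]
      simp [MachineState.next, hU, h]
    obtain ⟨hk, hmin, hle⟩ := h.2.choose_spec
    generalize h.2.choose = k at hs hk hmin hle
    refine exists_runFrom_cons hs ?_
    obtain ⟨r, hr, hq⟩ := ih (m + 1) (by omega) U (P.erase k) v tt (te + v k) (s ++ [Action.exec k])
      (by rw [after_observe_append, hst]; rfl) (fun i hi => hv i (Finset.mem_of_mem_erase hi))
      (by have := Finset.card_pos.2 ⟨k, hk⟩; rw [Finset.card_erase_of_mem hk]; omega)
    rw [hv k hk] at hle hq
    refine ⟨r, hr, execLong U P tt te r k h.1 hU hk (fun i hi => ?_) hle hq⟩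
    rw [← hv k hk, ← hv i hi]
    exact hmin i hi
  · have hs : A n I.ub (observe I s) = some (Action.test hU.choose) := by
      rw [hA, hst]
      simp [MachineState.next, hU, h]
    have hj := hU.choose_spec
    generalize hU.choose = j at hs hj
    have hwait : b → ∀ i ∈ P, tt < te + I.p i := by
      intro hb i hi
      by_contra hlt
      push Not at hlt
      obtain ⟨k, hk, hmin⟩ := Finset.exists_min_image P v ⟨i, hi⟩
      refine h ⟨hb, k, hk, hmin, ?_⟩
      have := hmin i hi
      rw [hv i hi] at this
      linarith
    have hcard : (U.erase j).card = U.card - 1 := Finset.card_erase_of_mem hj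
    refine exists_runFrom_cons hs ?_
    by_cases hp : I.p j ≤ E
    · have hst' : MachineState.after E (observe I (s ++ [Action.test j])) =
          ⟨U.erase j, P, v, tt, te, some j⟩ := by
        rw [after_observe_append, hst]
        simp [MachineState.step, hp]
      refine exists_runFrom_cons (a := Action.exec j) (Q := fun r => Q U P tt te (Action.test j :: r))
        (by rw [hA, hst']; rfl) ?_
      obtain ⟨r, hr, hq⟩ := ih m (by omega) (U.erase j) P v tt te
        (s ++ [Action.test j] ++ [Action.exec j])
        (by rw [after_observe_append, hst']; rfl) hv (by omega)
      exact ⟨r, hr, testShort U P tt te r j hj hwait hp hq⟩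
    · obtain ⟨r, hr, hq⟩ := ih (m + 1) (by omega) (U.erase j) (insert j P)
        (Function.update v j (I.p j)) (tt + 1) te (s ++ [Action.test j])
        (by rw [after_observe_append, hst]; simp [MachineState.step, hp])
        (fun i hi => by
          by_cases hij : i = j
          · subst hij; simp
          · simpa [hij] using hv i (Finset.mem_of_mem_insert_of_ne hi hij))
        (by have := Finset.card_insert_le j P; omega)
      exact ⟨r, hr, testLong U P tt te r j hj hwait (not_le.1 hp) hq⟩

/-- `T₂ ≥ 2` makes the untested branch of Threshold vacuous. -/
lemma implementsCombined_combined {T₁ T₂ : ℝ} (hT₂ : 2 ≤ T₂) :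
    (combined T₁ T₂).ImplementsCombined T₁ T₂ := by
  intro n I
  refine ⟨fun h => untestedRun_schedule fun s => by simp [combined, h], fun h1 h2 => ?_,
    fun h1 h2 => ⟨fun h => absurd h2 (by linarith), fun _ => ?_⟩⟩
  · have hA : ∀ s, combined T₁ T₂ n I.ub (observe I s) =
        (MachineState.after (max 1 (I.ub - 1)) (observe I s)).next True :=
      fun s => by simp [combined, not_lt.2 h1, h2]
    obtain ⟨r, hr, hq⟩ := runFrom_machine hA (Q := BeatFrom I (max 1 (I.ub - 1)))
      (fun _ _ _ _ h => .finish h)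
      (fun _ _ _ _ _ _ _ hU hk hmin hle hs => .execLong hU hk hmin hle hs)
      (fun _ _ _ _ _ _ hj hw hp hs => .testShort hj (hw trivial) hp hs)
      (fun _ _ _ _ _ _ hj hw hp hs => .testLong hj (hw trivial) hp hs)
      (2 * n) Finset.univ ∅ 0 0 0 [] rfl (by simp) (by simp)
    rw [OnlineAlgorithm.schedule, hr]
    exact hq
  · have hA : ∀ s, combined T₁ T₂ n I.ub (observe I s) =
        (MachineState.after 2 (observe I s)).next False :=
      fun s => by simp [combined, not_lt.2 h1, not_le.2 h2]
    obtain ⟨r, hr, hq⟩ := runFrom_machine hA (Q := fun U P _ _ s => ThresholdFrom I U P s)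
      (fun _ _ _ _ h => .finish h)
      (fun _ _ _ _ _ _ hb => hb.elim)
      (fun _ _ _ _ _ _ hj _ hp hs => .testShort hj hp hs)
      (fun _ _ _ _ _ _ hj _ hp hs => .testLong hj hp hs)
      (2 * n) Finset.univ ∅ 0 0 0 [] rfl (by simp) (by simp)
    rw [OnlineAlgorithm.schedule, hr]
    exact hq

end

/-! ### The asymptotic ratio -/

/-- The instance with `n` jobs of processing time `0` and upper limit `u`. -/
def zeroInstance (n : ℕ) (u : ℝ) (hu : 0 < u) : UniformInstance n where
  ub := u
  ub_pos := hu
  p := fun _ => 0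
  p_nonneg := fun _ => le_rfl
  p_le := fun _ => hu.le

lemma ofReal_le_iSup_ratio {A : OnlineAlgorithm} {T₁ T₂ : ℝ} (hT : 1 < T₁)
    (hA : A.ImplementsCombined T₁ T₂) {n : ℕ} (hn : 0 < n) :
    ENNReal.ofReal T₁ ≤
      ⨆ I : UniformInstance n, ENNReal.ofReal (cost I (A.schedule I) / opt I) := by
  have hn' : (0 : ℝ) < n := by exact_mod_cast hn
  have h : ∀ u ∈ Set.Ioo 1 T₁, ENNReal.ofReal u ≤
      ⨆ I : UniformInstance n, ENNReal.ofReal (cost I (A.schedule I) / opt I) := by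
    intro u hu
    have hu0 : 0 < u := one_pos.trans hu.1
    refine le_trans ?_ (le_iSup _ (zeroInstance n u hu0))
    apply ENNReal.ofReal_le_ofReal
    rw [cost_of_untestedRun _ ((hA n (zeroInstance n u hu0)).1 hu.2)]
    have h1 := opt_le_of_p_eq_zero (zeroInstance n u hu0) fun _ => rfl
    have h2 := le_opt (zeroInstance n u hu0) (c := 1) hu.1.le le_rfl
    have h3 : 0 < opt (zeroInstance n u hu0) := lt_of_lt_of_le (by positivity) h2
    rw [le_div_iff₀ h3]
    have : (zeroInstance n u hu0).ub = u := rfl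
    rw [this]
    nlinarith
  -- At `ub = T₁` itself Beat runs, so the value `T₁` is reached only as a limit of upper limits
  -- below it.
  have hcl : T₁ ∈ closure (Set.Ioo 1 T₁) := by
    rw [closure_Ioo hT.ne]
    exact Set.right_mem_Icc.2 hT.le
  have hmem := map_mem_closure ENNReal.continuous_ofReal hcl
    (t := Set.Iic (⨆ I : UniformInstance n, ENNReal.ofReal (cost I (A.schedule I) / opt I))) h
  rwa [isClosed_Iic.closure_eq] at hmem

lemma cost_le_of_implementsCombined {A : OnlineAlgorithm} {T₁ T₂ : ℝ}
    (hT : 193375 / 100000 < T₁) (hT' : T₁ < 193385 / 100000) (hT0 : polyOne T₁ = 0)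
    (hT₂ : 229475 / 100000 < T₂) (hT₂' : T₂ < 229485 / 100000)
    (hA : A.ImplementsCombined T₁ T₂) {n : ℕ} (hn : 0 < n) (I : UniformInstance n) :
    cost I (A.schedule I) ≤ T₁ * opt I + 25 * n := by
  have hn' : (0 : ℝ) < n := by exact_mod_cast hn
  obtain ⟨h1, h2, h3⟩ := hA n I
  rcases lt_or_ge I.ub T₁ with h | h
  · have := cost_le_of_untestedRun I (h1 h) (by linarith) h.le
    linarith
  rcases le_or_gt I.ub T₂ with h' | h'
  · exact cost_le_of_beatRun hT hT' hT0 h (by linarith) hn (h2 h h')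
  · have := cost_le_of_thresholdFrom hT (by linarith) ((h3 h h').2 (by linarith))
    linarith

/-- Small upper limits are treated apart: there `opt` can be arbitrarily small, and an additive
error would not be negligible. -/
lemma ratio_le_of_implementsCombined {A : OnlineAlgorithm} {T₁ T₂ : ℝ}
    (hT : 193375 / 100000 < T₁) (hT' : T₁ < 193385 / 100000) (hT0 : polyOne T₁ = 0)
    (hT₂ : 229475 / 100000 < T₂) (hT₂' : T₂ < 229485 / 100000)
    (hA : A.ImplementsCombined T₁ T₂) {n : ℕ} (hn : 0 < n) (I : UniformInstance n) :
    cost I (A.schedule I) / opt I ≤ T₁ + 50 / n := by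
  have hn' : (0 : ℝ) < n := by exact_mod_cast hn
  have hn1 : (1 : ℝ) ≤ n := by exact_mod_cast hn
  rcases lt_or_ge I.ub T₁ with h | h
  · have h1 := cost_le_of_untestedRun I ((hA n I).1 h) (by linarith) h.le
    have h0 : 0 < opt I := by
      have h2 := le_opt I (min_le_left I.ub 1) (min_le_right I.ub 1)
      have h3 : 0 < min I.ub 1 := lt_min I.ub_pos one_pos
      exact lt_of_lt_of_le (by positivity) h2
    have h4 : 0 ≤ 50 / (n : ℝ) := by positivity
    have h5 := (div_le_iff₀ h0).2 h1
    linarith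
  · have h1 := cost_le_of_implementsCombined hT hT' hT0 hT₂ hT₂' hA hn I
    have h2 := le_opt I (c := 1) (by linarith) le_rfl
    have h3 : (n : ℝ) ^ 2 / 2 ≤ opt I := by nlinarith
    have h0 : 0 < opt I := lt_of_lt_of_le (by positivity) h3
    rw [div_le_iff₀ h0]
    have h4 : 50 / (n : ℝ) * (n ^ 2 / 2) ≤ 50 / n * opt I := by gcongr
    have h5 : 50 / (n : ℝ) * (n ^ 2 / 2) = 25 * n := by field_simp; norm_num
    linarith

lemma hasAsymptoticRatio_of_implementsCombined {A : OnlineAlgorithm} {T₁ T₂ : ℝ}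
    (hT : 193375 / 100000 < T₁) (hT' : T₁ < 193385 / 100000) (hT0 : polyOne T₁ = 0)
    (hT₂ : 229475 / 100000 < T₂) (hT₂' : T₂ < 229485 / 100000)
    (hA : A.ImplementsCombined T₁ T₂) : A.HasAsymptoticRatio T₁ := by
  have hlim : Tendsto (fun n : ℕ => ENNReal.ofReal (T₁ + 50 / n)) atTop
      (𝓝 (ENNReal.ofReal T₁)) := by
    refine ENNReal.tendsto_ofReal ?_
    simpa using (tendsto_const_div_atTop_nhds_zero_nat (50 : ℝ)).const_add T₁
  refine tendsto_of_tendsto_of_tendsto_of_le_of_le' tendsto_const_nhds hlim ?_ ?_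
  · filter_upwards [eventually_gt_atTop 0] with n hn
    exact ofReal_le_iSup_ratio (by linarith) hA hn
  · filter_upwards [eventually_gt_atTop 0] with n hn
    exact iSup_le fun I => ENNReal.ofReal_le_ofReal
      (ratio_le_of_implementsCombined hT hT' hT0 hT₂ hT₂' hA hn I)

end SchedTest

theorem mainTheorem5 :
    ∃ T₁ T₂ : ℝ,
      |T₁ - 1.9338| < 0.00005 ∧ |T₂ - 2.2948| < 0.00005 ∧
      (∀ x : ℝ, 0 ≤ (1 - 2 * x) ^ 2 * (4 * x - 3) →
        (2 * x ^ 3 - 4 * x ^ 2 + 4 * x - 1 - Real.sqrt ((1 - 2 * x) ^ 2 * (4 * x - 3)) = 0 ↔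
          x = 1 ∨ x = T₁)) ∧
      (∀ x : ℝ, 2 < x → x < 3 → (SchedTest.rhoBeat x = SchedTest.rhoThreshold x ↔ x = T₂)) ∧
      (∃ A : SchedTest.OnlineAlgorithm, A.ImplementsCombined T₁ T₂) ∧
      (∀ A : SchedTest.OnlineAlgorithm, A.ImplementsCombined T₁ T₂ → A.HasAsymptoticRatio T₁) := by
  obtain ⟨T₁, h1, h1', h10⟩ := SchedTest.exists_polyOne_root
  obtain ⟨T₂, h2, h2', h20⟩ := SchedTest.exists_polyTwo_root
  refine ⟨T₁, T₂, ?_, ?_, fun x hx => SchedTest.cubic_eq_sqrt_iff h1 h10 hx,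
    fun x hx _ => SchedTest.rhoBeat_eq_rhoThreshold_iff (by linarith) h20 hx,
    ⟨_, SchedTest.implementsCombined_combined (by linarith)⟩,
    fun A hA => SchedTest.hasAsymptoticRatio_of_implementsCombined h1 h1' h10 h2 h2' hA⟩
  · rw [abs_lt]
    constructor <;> norm_num <;> linarith
  · rw [abs_lt]
    constructor <;> norm_num <;> linarith
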